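/- Let $A$ be a $C^*$-algebra (not necessarily unital) and let $X$ be a $C^*$-correspondence over $A$, i.e. a right Hilbert $A$-module together with a $*$-homomorphism $\varphi_X : A \to \mathcal L(X)$ into the adjointable operators. No further conditions are imposed: $X$ need not be full, and $\varphi_X$ need be neither injective nor non-degenerate. For $\xi,\eta\in X$ let $\theta_{\xi,\eta}(\zeta)=\xi\langle\eta,\zeta\rangle$, let $\mathcal K(X)\subset\mathcal L(X)$ be the closed linear span of the $\theta_{\xi,\eta}$, and let $$J_X=\varphi_X^{-1}(\mathcal K(X))\cap(\ker\varphi_X)^\perp,\qquad (\ker\varphi_X)^\perp=\{a\in A : ab=0 \text{ for all } b\in\ker\varphi_X\}.$$ A representation of $X$ on a $C^*$-algebra $B$ is a pair $(\pi,t)$ of a $*$-homomorphism $\pi:A\to B$ and a linear map $t:X\to B$ such that $t(\xi)^*t(\eta)=\pi(\langle\xi,\eta\rangle)$ and $\pi(a)t(\xi)=t(\varphi_X(a)\xi)$ for all $\xi,\eta\in X$, $a\in A$. It determines a $*$-homomorphism $\psi_t:\mathcal K(X)\to B$ with $\psi_t(\theta_{\xi,\eta})=t(\xi)t(\eta)^*$,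 and it is called covariant if $\pi(a)=\psi_t(\varphi_X(a))$ for all $a\in J_X$. Let $\mathcal O_X=C^*(\pi_X,t_X)$ be the $C^*$-algebra generated by the universal covariant representation $(\pi_X,t_X)$ of $X$: every covariant representation $(\pi,t)$ on a $C^*$-algebra $B$ is of the form $(\rho\circ\pi_X,\rho\circ t_X)$ for a unique $*$-homomorphism $\rho:\mathcal O_X\to B$. **Proposition.** The universal covariant representation $(\pi_X,t_X)$ of $X$ on $\mathcal O_X$ exists and is injective, that is, $\pi_X:A\to\mathcal O_X$ is injective. Consequently $\pi_X$ is an isometric embedding of $A$ into $\mathcal O_X$, and $t_X:X\to\mathcal O_X$ is isometric. -/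

import Mathlib

set_option linter.unusedSectionVars false
set_option linter.style.haveILetI false

namespace CStarCorr

open scoped ENNReal RightActions

noncomputable section

universe u v w

/-- A (right) Hilbert `A`-module: a complex Banach space `X` (completeness is the separate
assumption `[CompleteSpace X]`) with a right action `ξ <• a` of the C⋆-algebra `A` and an `A`-valued
inner product, linear in the second variable, which induces the norm. -/
class HilbertModule (A : Type u) (X : Type v) [NonUnitalCStarAlgebra A] [PartialOrder A]
    [NormedAddCommGroup X] [NormedSpace ℂ X] [SMul Aᵐᵒᵖ X] extends Inner A X where
  add_act (ξ η : X) (a : A) : (ξ + η) <• a = ξ <• a + η <• a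
  act_add (ξ : X) (a b : A) : ξ <• (a + b) = ξ <• a + ξ <• b
  act_mul (ξ : X) (a b : A) : ξ <• (a * b) = (ξ <• a) <• b
  smul_act (z : ℂ) (ξ : X) (a : A) : (z • ξ) <• a = z • (ξ <• a)
  act_smul (z : ℂ) (ξ : X) (a : A) : ξ <• (z • a) = z • (ξ <• a)
  inner_add (ξ η ζ : X) : inner ξ (η + ζ) = inner ξ η + inner ξ ζ
  inner_smul (z : ℂ) (ξ η : X) : inner ξ (z • η) = z • inner ξ η
  inner_act (ξ η : X) (a : A) : inner ξ (η <• a) = inner ξ η * a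
  inner_star (ξ η : X) : star (inner η ξ) = inner ξ η
  inner_nonneg (ξ : X) : 0 ≤ inner ξ ξ
  norm_eq (ξ : X) : ‖ξ‖ = √‖inner ξ ξ‖

section Module

variable {A : Type u} {X : Type v} [NonUnitalCStarAlgebra A] [PartialOrder A] [StarOrderedRing A]
  [NormedAddCommGroup X] [NormedSpace ℂ X] [SMul Aᵐᵒᵖ X] [HilbertModule A X]

open HilbertModule


lemma norm_sq (ξ : X) : ‖ξ‖ ^ 2 = ‖inner A ξ ξ‖ := by
  rw [norm_eq (A := A) ξ, Real.sq_sqrt (norm_nonneg _)]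

lemma inner_zero_right (ξ : X) : inner A ξ (0 : X) = 0 := by
  have := inner_smul (A := A) (0 : ℂ) ξ 0
  simpa using this

lemma inner_add_left (ξ η ζ : X) : inner A (ξ + η) ζ = inner A ξ ζ + inner A η ζ := by
  rw [← inner_star, inner_add, star_add, inner_star, inner_star]

lemma inner_smul_left (z : ℂ) (ξ η : X) : inner A (z • ξ) η = star z • inner A ξ η := by
  rw [← inner_star, inner_smul, star_smul, inner_star]

lemma inner_act_left (ξ η : X) (a : A) : inner A (ξ <• a) η = star a * inner A ξ η := by
  rw [← inner_star, inner_act, star_mul, inner_star]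

lemma inner_neg_right (ξ η : X) : inner A ξ (-η) = -inner A ξ η := by
  have := inner_smul (A := A) (-1 : ℂ) ξ η
  simpa using this

lemma inner_sub_right (ξ η ζ : X) : inner A ξ (η - ζ) = inner A ξ η - inner A ξ ζ := by
  rw [sub_eq_add_neg, inner_add, inner_neg_right, sub_eq_add_neg]

variable (A) in
lemma eq_zero_of_inner_self {ξ : X} (h : inner A ξ ξ = 0) : ξ = 0 := by
  have := norm_sq (A := A) ξ
  rw [h, norm_zero] at this
  exact norm_eq_zero.mp (pow_eq_zero_iff two_ne_zero |>.mp this)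

variable (A) in
lemma ext_inner {ξ η : X} (h : ∀ ζ : X, inner A ζ ξ = inner A ζ η) : ξ = η := by
  rw [← sub_eq_zero]
  apply eq_zero_of_inner_self A
  rw [inner_sub_right, h, sub_self]

/-- The Cauchy-Schwarz inequality. -/
lemma norm_inner_le (ξ η : X) : ‖inner A ξ η‖ ≤ ‖ξ‖ * ‖η‖ := by
  letI : PartialOrder Aᵐᵒᵖ := CStarAlgebra.spectralOrder Aᵐᵒᵖ
  haveI : StarOrderedRing Aᵐᵒᵖ := CStarAlgebra.spectralOrderedRing Aᵐᵒᵖ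
  letI : CStarModule Aᵐᵒᵖ X :=
    { inner := fun x y => MulOpposite.op (inner A x y)
      inner_add_right := fun {x y z} => by simp [inner_add]
      inner_self_nonneg := fun {x} => by
        obtain ⟨b, hb⟩ := CStarAlgebra.nonneg_iff_eq_star_mul_self.mp (inner_nonneg (A := A) x)
        rw [hb, MulOpposite.op_mul, MulOpposite.op_star]
        exact mul_star_self_nonneg _
      inner_self := fun {x} => by
        simp only [MulOpposite.op_eq_zero_iff]
        refine ⟨eq_zero_of_inner_self A, ?_⟩
        rintro rfl
        exact inner_zero_right _
      inner_op_smul_right := fun {a x y} => by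
        have := inner_act (A := A) x y a.unop
        simp only [MulOpposite.op_unop] at this
        rw [this]; simp
      inner_smul_right_complex := fun {z x y} => by rw [inner_smul]; rfl
      star_inner := fun x y => by rw [← MulOpposite.op_star, inner_star]
      norm_eq_sqrt_norm_inner_self := fun x => by rw [norm_eq (A := A) x]; rfl }
  exact CStarModule.norm_inner_le (A := Aᵐᵒᵖ) X (x := ξ) (y := η)

lemma norm_act_le (ξ : X) (a : A) : ‖ξ <• a‖ ≤ ‖ξ‖ * ‖a‖ := by
  refine le_of_sq_le_sq ?_ (by positivity)
  rw [norm_sq (A := A), inner_act_left, inner_act, mul_pow, norm_sq (A := A) ξ]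
  calc ‖star a * (inner A ξ ξ * a)‖ ≤ ‖a‖ * (‖inner A ξ ξ‖ * ‖a‖) := by
        refine (norm_mul_le _ _).trans ?_
        rw [norm_star]
        gcongr
        exact norm_mul_le _ _
    _ = _ := by ring

lemma continuous_inner_right (ξ : X) : Continuous fun η : X => inner A ξ η :=
  AddMonoidHomClass.continuous_of_bound
    (AddMonoidHom.mk' (fun η : X => inner A ξ η) (inner_add ξ)) ‖ξ‖ (norm_inner_le ξ)

end Module

section Adjointable

variable (A : Type u) (X : Type v) [NonUnitalCStarAlgebra A] [PartialOrder A] [StarOrderedRing A]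
  [NormedAddCommGroup X] [NormedSpace ℂ X] [CompleteSpace X] [SMul Aᵐᵒᵖ X] [HilbertModule A X]

open HilbertModule

/-- The adjointable operators on `X`, as a subalgebra of the algebra of bounded operators. -/
def adjointable : Subalgebra ℂ (X →L[ℂ] X) where
  carrier := {T | ∃ S : X →L[ℂ] X, ∀ ξ η, inner A (T ξ) η = inner A ξ (S η)}
  mul_mem' := by
    rintro T₁ T₂ ⟨S₁, h₁⟩ ⟨S₂, h₂⟩
    exact ⟨S₂ * S₁, fun ξ η => by simp [h₁, h₂]⟩
  add_mem' := by
    rintro T₁ T₂ ⟨S₁, h₁⟩ ⟨S₂, h₂⟩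
    exact ⟨S₁ + S₂, fun ξ η => by simp [inner_add_left, inner_add, h₁, h₂]⟩
  algebraMap_mem' z := ⟨star z • 1, fun ξ η => by
    simp [Algebra.algebraMap_eq_smul_one, inner_smul_left, inner_smul]⟩

variable {A X}

/-- The adjoint of an adjointable operator, as an operator on `X`. -/
def adjFun (T : adjointable A X) : X →L[ℂ] X := T.2.choose

lemma inner_adjFun (T : adjointable A X) (ξ η : X) :
    inner A ((T : X →L[ℂ] X) ξ) η = inner A ξ (adjFun T η) := T.2.choose_spec ξ η

lemma adjFun_inner (T : adjointable A X) (ξ η : X) :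
    inner A (adjFun T ξ) η = inner A ξ ((T : X →L[ℂ] X) η) := by
  rw [← inner_star, ← inner_adjFun, inner_star]

instance : Star (adjointable A X) where
  star T := ⟨adjFun T, (T : X →L[ℂ] X), adjFun_inner T⟩

lemma inner_left' (T : adjointable A X) (ξ η : X) :
    inner A ((T : X →L[ℂ] X) ξ) η = inner A ξ (((star T : adjointable A X) : X →L[ℂ] X) η) :=
  inner_adjFun T ξ η

lemma inner_right' (T : adjointable A X) (ξ η : X) :
    inner A ξ ((T : X →L[ℂ] X) η) = inner A (((star T : adjointable A X) : X →L[ℂ] X) ξ) η :=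
  (adjFun_inner T ξ η).symm

lemma adj_ext' {T S : adjointable A X}
    (h : ∀ ξ η : X, inner A ξ ((T : X →L[ℂ] X) η) = inner A ξ ((S : X →L[ℂ] X) η)) : T = S :=
  Subtype.ext (ContinuousLinearMap.ext fun η => ext_inner A fun ξ => h ξ η)

lemma adj_mul_apply' (T S : adjointable A X) (ξ : X) :
    ((T * S : adjointable A X) : X →L[ℂ] X) ξ = (T : X →L[ℂ] X) ((S : X →L[ℂ] X) ξ) := rfl

instance : StarRing (adjointable A X) where
  star_involutive T := adj_ext' fun ξ η => by rw [← inner_left', ← inner_right']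
  star_mul T S := adj_ext' fun ξ η => by
    rw [← inner_left']
    simp only [adj_mul_apply', inner_left']
  star_add T S := adj_ext' fun ξ η => by
    rw [← inner_left']
    simp only [AddMemClass.coe_add, _root_.add_apply, inner_left', inner_add_left,
      inner_add]

instance : StarModule ℂ (adjointable A X) where
  star_smul z T := adj_ext' fun ξ η => by
    rw [← inner_left']
    simp only [SetLike.val_smul, _root_.smul_apply, inner_left', inner_smul_left,
      inner_smul]

lemma adj_norm_sq_le (T : adjointable A X) : ‖T‖ * ‖T‖ ≤ ‖star T * T‖ := by
  have h : ‖(T : X →L[ℂ] X)‖ ≤ √‖star T * T‖ := by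
    refine ContinuousLinearMap.opNorm_le_bound _ (Real.sqrt_nonneg _) fun ξ => ?_
    refine le_of_sq_le_sq ?_ (by positivity)
    rw [norm_sq (A := A), inner_left', mul_pow, Real.sq_sqrt (norm_nonneg (star T * T)), pow_two ‖ξ‖]
    refine (norm_inner_le _ _).trans ?_
    have : ‖((star T * T : adjointable A X) : X →L[ℂ] X) ξ‖ ≤ ‖star T * T‖ * ‖ξ‖ :=
      ContinuousLinearMap.le_opNorm _ _
    calc _ ≤ ‖ξ‖ * (‖star T * T‖ * ‖ξ‖) := by gcongr; exact this
      _ = _ := by ring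
  calc ‖T‖ * ‖T‖ ≤ √‖star T * T‖ * √‖star T * T‖ := by gcongr <;> exact h
    _ = _ := Real.mul_self_sqrt (norm_nonneg _)

instance : CStarRing (adjointable A X) where
  norm_mul_self_le := adj_norm_sq_le

lemma isClosed_adjointable : IsClosed (adjointable A X : Set (X →L[ℂ] X)) := by
  have hiso : Isometry (star : adjointable A X → adjointable A X) :=
    (starₗᵢ ℂ : adjointable A X ≃ₗᵢ⋆[ℂ] adjointable A X).isometry
  rw [← isSeqClosed_iff_isClosed]
  intro T T' hT hlim
  let T₁ : ℕ → adjointable A X := fun n => ⟨T n, hT n⟩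
  have hc : CauchySeq T₁ := by
    refine (isometry_subtype_coe.isUniformInducing.cauchy_map_iff).mp ?_
    rw [Filter.map_map]
    exact hlim.cauchySeq
  have hc' : CauchySeq fun n => ((star (T₁ n) : adjointable A X) : X →L[ℂ] X) :=
    (isometry_subtype_coe.comp hiso).uniformContinuous.comp_cauchySeq hc
  obtain ⟨S, hS⟩ := cauchySeq_tendsto_of_complete hc'
  refine ⟨S, fun ξ η => ?_⟩
  have h1 : Filter.Tendsto (fun n => inner A η (T n ξ)) Filter.atTop (nhds (inner A η (T' ξ))) :=
    ((continuous_inner_right η).tendsto _).comp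
      (((ContinuousLinearMap.apply ℂ X ξ).continuous.tendsto T').comp hlim)
  have h2 : Filter.Tendsto (fun n => inner A ξ (((star (T₁ n) : adjointable A X) : X →L[ℂ] X) η))
      Filter.atTop (nhds (inner A ξ (S η))) :=
    ((continuous_inner_right ξ).tendsto _).comp
      (((ContinuousLinearMap.apply ℂ X η).continuous.tendsto S).comp hS)
  have h3 := h1.star
  simp only [inner_star] at h3
  refine tendsto_nhds_unique h3 (h2.congr fun n => ?_)
  exact (inner_left' (T₁ n) ξ η).symm

instance : CStarAlgebra (adjointable A X) where
  toCompleteSpace := isClosed_adjointable.completeSpace_coe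

variable (A X) in
/-- `𝓛(X)`, the C⋆-algebra of adjointable operators on `X`: the operations and the norm are those of
operators, and `star` is the adjoint. -/
def Adj : Type v := adjointable A X

instance : CStarAlgebra (Adj A X) := inferInstanceAs (CStarAlgebra (adjointable A X))

/-- An adjointable operator, as a bounded operator. -/
def Adj.op (T : Adj A X) : X →L[ℂ] X := Subtype.val (p := fun S => S ∈ adjointable A X) T

/-- An operator with an adjoint, as an element of `𝓛(X)`. -/
def Adj.mk (T S : X →L[ℂ] X) (h : ∀ ξ η, inner A (T ξ) η = inner A ξ (S η)) : Adj A X :=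
  Subtype.mk (p := fun S => S ∈ adjointable A X) T ⟨S, h⟩

lemma Adj.op_mk (T S : X →L[ℂ] X) (h : ∀ ξ η, inner A (T ξ) η = inner A ξ (S η)) :
    (Adj.mk T S h).op = T := rfl

lemma Adj.op_add (T S : Adj A X) : (T + S).op = T.op + S.op := rfl

lemma Adj.op_smul (z : ℂ) (T : Adj A X) : (z • T).op = z • T.op := rfl

lemma Adj.op_zero : (0 : Adj A X).op = 0 := rfl

lemma Adj.op_mul (T S : Adj A X) : (T * S).op = T.op * S.op := rfl

lemma Adj.norm_op (T : Adj A X) : ‖T.op‖ = ‖T‖ := rfl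

lemma Adj.op_injective {T S : Adj A X} (h : T.op = S.op) : T = S := Subtype.ext h

lemma inner_left (T : Adj A X) (ξ η : X) : inner A (T.op ξ) η = inner A ξ ((star T).op η) :=
  inner_left' (A := A) T ξ η

lemma inner_right (T : Adj A X) (ξ η : X) : inner A ξ (T.op η) = inner A ((star T).op ξ) η :=
  inner_right' (A := A) T ξ η

lemma adj_ext {T S : Adj A X} (h : ∀ ξ η : X, inner A ξ (T.op η) = inner A ξ (S.op η)) : T = S :=
  Adj.op_injective (ContinuousLinearMap.ext fun η => ext_inner A fun ξ => h ξ η)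

lemma act_adj (T : Adj A X) (ξ : X) (a : A) :
    T.op (ξ <• a) = T.op ξ <• a :=
  ext_inner A fun ζ => by
    rw [inner_right, inner_act, inner_act, inner_right]

variable (A) in
/-- The map `ζ ↦ ξ ⟪η, ζ⟫` on `X`. -/
def thetaFun (ξ η : X) : X →L[ℂ] X :=
  LinearMap.mkContinuous
    { toFun := fun ζ => ξ <• (inner A η ζ : A)
      map_add' := fun ζ ζ' => by rw [inner_add, act_add]
      map_smul' := fun z ζ => by rw [inner_smul, act_smul]; rfl }
    (‖ξ‖ * ‖η‖) fun ζ => by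
      refine (norm_act_le ξ (inner A η ζ)).trans ?_
      rw [mul_assoc]
      gcongr
      exact norm_inner_le _ _

variable (A) in
lemma thetaFun_apply (ξ η ζ : X) : thetaFun A ξ η ζ = ξ <• (inner A η ζ : A) := rfl

lemma inner_thetaFun (ξ η ζ ζ' : X) :
    inner A (thetaFun A ξ η ζ) ζ' = inner A ζ (thetaFun A η ξ ζ') := by
  rw [thetaFun_apply, thetaFun_apply, inner_act_left, inner_act, inner_star]

variable (A) in
/-- The rank-one operator `θ_{ξ,η}`, which maps `ζ` to `ξ ⟪η, ζ⟫`. -/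
def theta (ξ η : X) : Adj A X := 
  Adj.mk (thetaFun A ξ η) (thetaFun A η ξ) (inner_thetaFun ξ η)

variable (A) in
lemma theta_apply (ξ η ζ : X) : (theta A ξ η).op ζ = ξ <• (inner A η ζ : A) := rfl

lemma star_theta (ξ η : X) : star (theta A ξ η) = theta A η ξ := adj_ext fun ζ ζ' => by
  rw [← inner_left]
  exact inner_thetaFun ξ η ζ ζ'

lemma mul_theta (T : Adj A X) (ξ η : X) :
    T * theta A ξ η = theta A (T.op ξ) η :=
  Adj.op_injective <| ContinuousLinearMap.ext fun ζ => act_adj T ξ (inner A η ζ)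

variable (A X) in
/-- The linear span of the rank-one operators, as a ⋆-subalgebra of `𝓛(X)`. -/
def finiteRank : NonUnitalStarSubalgebra ℂ (Adj A X) where
  __ := Submodule.span ℂ (Set.range fun p : X × X => theta A p.1 p.2)
  mul_mem' := by
    intro S T _ hT
    induction hT using Submodule.span_induction with
    | mem T h =>
      obtain ⟨p, rfl⟩ := h
      dsimp only
      rw [mul_theta]
      exact Submodule.subset_span ⟨(_, _), rfl⟩
    | zero => simp
    | add x y _ _ hx hy => rw [mul_add]; exact Submodule.add_mem _ hx hy
    | smul z x _ hx => rw [mul_smul_comm]; exact Submodule.smul_mem _ z hx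
  star_mem' := by
    intro T hT
    induction hT using Submodule.span_induction with
    | mem T h =>
      obtain ⟨p, rfl⟩ := h
      dsimp only
      rw [star_theta]
      exact Submodule.subset_span ⟨(_, _), rfl⟩
    | zero => simp
    | add x y _ _ hx hy => rw [star_add]; exact Submodule.add_mem _ hx hy
    | smul z x _ hx => rw [star_smul]; exact Submodule.smul_mem _ _ hx

lemma mem_finiteRank {T : Adj A X} : T ∈ finiteRank A X ↔
    T ∈ Submodule.span ℂ (Set.range fun p : X × X => theta A p.1 p.2) := Iff.rfl

lemma theta_mem_finiteRank (ξ η : X) : theta A ξ η ∈ finiteRank A X :=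
  Submodule.subset_span ⟨(ξ, η), rfl⟩

variable (A X) in
/-- `𝓚(X)`, the closed linear span of the operators `θ_{ξ,η}` in `𝓛(X)`. -/
def compacts : NonUnitalStarSubalgebra ℂ (Adj A X) := (finiteRank A X).topologicalClosure

instance : IsClosed (compacts A X : Set (Adj A X)) :=
  (finiteRank A X).isClosed_topologicalClosure

instance : NonUnitalCStarAlgebra (compacts A X) :=
  NonUnitalStarSubalgebra.nonUnitalCStarAlgebra _

variable (A) in
/-- The rank-one operator `θ_{ξ,η}` as an element of `𝓚(X)`. -/
def thetaK (ξ η : X) : compacts A X :=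
  ⟨theta A ξ η, (finiteRank A X).le_topologicalClosure (theta_mem_finiteRank ξ η)⟩

end Adjointable

section HomLemmas

variable {C B : Type*} [NonUnitalCStarAlgebra C] [NonUnitalCStarAlgebra B]

/-- A contractive ⋆-homomorphism given on a dense ⋆-subalgebra by its graph extends. -/
lemma exists_hom (S : NonUnitalStarSubalgebra ℂ (C × B)) (h : ∀ p ∈ S, ‖p.2‖ ≤ ‖p.1‖)
    (hd : Dense (Prod.fst '' (S : Set (C × B)))) :
    ∃ ρ : C →⋆ₙₐ[ℂ] B, ∀ p ∈ S, ρ p.1 = p.2 := by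
  let G := S.topologicalClosure
  have hGc : IsClosed (G : Set (C × B)) := S.isClosed_topologicalClosure
  have hG : ∀ p ∈ G, ‖p.2‖ ≤ ‖p.1‖ := by
    intro p hp
    have hcl : IsClosed {p : C × B | ‖p.2‖ ≤ ‖p.1‖} :=
      isClosed_le (continuous_norm.comp continuous_snd) (continuous_norm.comp continuous_fst)
    exact closure_minimal (fun q hq => h q hq) hcl hp
  let f : G →⋆ₙₐ[ℂ] C :=
    (NonUnitalStarAlgHom.fst ℂ C B).comp (NonUnitalStarSubalgebraClass.subtype G)
  have hf : Isometry f := by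
    refine AddMonoidHomClass.isometry_of_norm f fun p => ?_
    change ‖p.1.1‖ = ‖p.1‖
    rw [Prod.norm_def, max_eq_left (hG p.1 p.2)]
  haveI : CompleteSpace G := hGc.completeSpace_coe
  have hsurj : Function.Surjective f := by
    intro c
    have hr : IsClosed (Set.range f) := hf.isClosedEmbedding.isClosed_range
    have : Prod.fst '' (S : Set (C × B)) ⊆ Set.range f := by
      rintro _ ⟨p, hp, rfl⟩
      exact ⟨⟨p, S.le_topologicalClosure hp⟩, rfl⟩
    exact closure_minimal this hr (hd c)
  let e : G ≃⋆ₐ[ℂ] C := StarAlgEquiv.ofBijective f ⟨hf.injective, hsurj⟩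
  refine ⟨((NonUnitalStarAlgHom.snd ℂ C B).comp (NonUnitalStarSubalgebraClass.subtype G)).comp
    (e.symm : C →⋆ₙₐ[ℂ] G), fun p hp => ?_⟩
  have : e.symm p.1 = ⟨p, S.le_topologicalClosure hp⟩ := by
    rw [StarAlgEquiv.symm_apply_eq]
    rfl
  change (e.symm p.1).1.2 = p.2
  rw [this]

lemma hom_continuous (ρ : C →⋆ₙₐ[ℂ] B) : Continuous ρ :=
  AddMonoidHomClass.continuous_of_bound ρ 1 fun x => by
    simpa using NonUnitalStarAlgHom.norm_apply_le ρ x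

lemma hom_ext {ρ σ : C →⋆ₙₐ[ℂ] B} (s : Set C)
    (hs : (NonUnitalStarAlgebra.adjoin ℂ s).topologicalClosure = ⊤)
    (h : ∀ x ∈ s, ρ x = σ x) : ρ = σ := by
  have h1 : NonUnitalStarAlgebra.adjoin ℂ s ≤ NonUnitalStarAlgHom.equalizer ρ σ :=
    NonUnitalStarAlgebra.adjoin_le h
  have h2 : IsClosed (NonUnitalStarAlgHom.equalizer ρ σ : Set C) :=
    isClosed_eq (hom_continuous ρ) (hom_continuous σ)
  ext x
  have hx : x ∈ (NonUnitalStarAlgebra.adjoin ℂ s).topologicalClosure := by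
    rw [hs]; exact NonUnitalStarAlgebra.mem_top
  exact NonUnitalStarSubalgebra.topologicalClosure_minimal _ h1 h2 hx

/-- The linear span of a set closed under products and adjoints, as a ⋆-subalgebra. -/
def spanStar (s : Set C) (hm : ∀ x ∈ s, ∀ y ∈ s, x * y ∈ s) (hs : ∀ x ∈ s, star x ∈ s) :
    NonUnitalStarSubalgebra ℂ C where
  __ := Submodule.span ℂ s
  mul_mem' := by
    intro x y hx hy
    induction hx using Submodule.span_induction with
    | mem x hx =>
      induction hy using Submodule.span_induction with
      | mem y hy => exact Submodule.subset_span (hm x hx y hy)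
      | zero => rw [mul_zero]; exact Submodule.zero_mem _
      | add y y' _ _ hy hy' => rw [mul_add]; exact Submodule.add_mem _ hy hy'
      | smul z y _ hy => rw [mul_smul_comm]; exact Submodule.smul_mem _ z hy
    | zero => rw [zero_mul]; exact Submodule.zero_mem _
    | add x x' _ _ hx hx' => rw [add_mul]; exact Submodule.add_mem _ hx hx'
    | smul z x _ hx => rw [smul_mul_assoc]; exact Submodule.smul_mem _ z hx
  star_mem' := by
    intro x hx
    induction hx using Submodule.span_induction with
    | mem x hx => exact Submodule.subset_span (hs x hx)
    | zero => rw [star_zero]; exact Submodule.zero_mem _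
    | add x y _ _ hx hy => rw [star_add]; exact Submodule.add_mem _ hx hy
    | smul z x _ hx => rw [star_smul]; exact Submodule.smul_mem _ _ hx

lemma spanStar_induction {s : Set C} {hm hs} {P : C → Prop} (hg : ∀ x ∈ s, P x) (h0 : P 0)
    (ha : ∀ x y, P x → P y → P (x + y)) (hc : ∀ (z : ℂ) x, P x → P (z • x)) {x : C}
    (hx : x ∈ spanStar s hm hs) : P x := by
  replace hx : x ∈ Submodule.span ℂ s := hx
  induction hx using Submodule.span_induction with
  | mem x hx => exact hg x hx
  | zero => exact h0
  | add x y _ _ hx hy => exact ha x y hx hy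
  | smul z x _ hx => exact hc z x hx

/-- Iterated products: `iter q n = q ^ (n + 1)`. -/
def iter (q : C) : ℕ → C
  | 0 => q
  | n + 1 => iter q n * q

lemma iter_mul (q : C) (m n : ℕ) : iter q m * iter q n = iter q (m + n + 1) := by
  induction n with
  | zero => rfl
  | succ n ih =>
    change iter q m * (iter q n * q) = iter q (m + n + 1) * q
    rw [← ih, mul_assoc]

lemma norm_iter_le (q : C) (n : ℕ) : ‖iter q n‖ ≤ ‖q‖ ^ (n + 1) := by
  induction n with
  | zero => simp [iter]
  | succ n ih =>
    refine (norm_mul_le _ _).trans ?_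
    rw [pow_succ]
    gcongr

lemma star_iter {q : C} (hq : star q = q) (n : ℕ) : star (iter q n) = iter q n := by
  induction n with
  | zero => exact hq
  | succ n ih =>
    change star (iter q n * q) = _
    rw [star_mul, ih, hq]
    have := iter_mul q 0 n
    rw [zero_add] at this
    exact this

lemma norm_iter {q : C} (hq : star q = q) (k : ℕ) : ‖iter q (2 ^ k - 1)‖ = ‖q‖ ^ 2 ^ k := by
  induction k with
  | zero => simp [iter]
  | succ k ih =>
    have h1 : 2 ^ (k + 1) - 1 = (2 ^ k - 1) + (2 ^ k - 1) + 1 := by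
      have := Nat.one_le_two_pow (n := k)
      omega
    have h2 := CStarRing.norm_star_mul_self (x := iter q (2 ^ k - 1))
    rw [star_iter hq] at h2
    rw [h1, ← iter_mul, h2, ih, pow_succ 2 k, pow_mul, pow_two]

lemma le_of_pow_le {a b c : ℝ} (ha : 0 ≤ a)
    (h : ∀ k : ℕ, 1 ≤ k → b ^ 2 ^ k ≤ c * a ^ (2 ^ k - 1)) : b ≤ a := by
  by_contra! hab
  have hb : 0 < b := ha.trans_lt hab
  rcases ha.eq_or_lt with rfl | ha
  · have := h 1 le_rfl
    norm_num at this
    nlinarith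
  · obtain ⟨n, hn⟩ := pow_unbounded_of_one_lt (c / a) ((one_lt_div ha).mpr hab)
    have h1 : (b / a) ^ n ≤ (b / a) ^ 2 ^ (n + 1) :=
      pow_le_pow_right₀ ((one_lt_div ha).mpr hab).le
        (Nat.lt_two_pow_self.le.trans (Nat.pow_le_pow_right (by norm_num) (Nat.le_succ n)))
    have h2 := h (n + 1) (by omega)
    have h3 : a ^ 2 ^ (n + 1) = a * a ^ (2 ^ (n + 1) - 1) := by
      rw [← pow_succ', Nat.sub_add_cancel Nat.one_le_two_pow]
    have h4 : (b / a) ^ 2 ^ (n + 1) ≤ c / a := by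
      rw [div_pow, h3, div_le_div_iff₀ (by positivity) ha]
      nlinarith
    linarith

end HomLemmas

section Correspondence

variable {A : Type u} {X : Type v} [NonUnitalCStarAlgebra A] [PartialOrder A] [StarOrderedRing A]
  [NormedAddCommGroup X] [NormedSpace ℂ X] [CompleteSpace X] [SMul Aᵐᵒᵖ X] [HilbertModule A X]

/-- A representation, on a C⋆-algebra `B`, of the C⋆-correspondence given by the Hilbert `A`-module
`X` and the left action `φ : A → 𝓛(X)`. -/
structure Representation (φ : A →⋆ₙₐ[ℂ] Adj A X) (B : Type w)
    [NonUnitalCStarAlgebra B] where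
  π : A →⋆ₙₐ[ℂ] B
  t : X →ₗ[ℂ] B
  star_t_mul_t (ξ η : X) : star (t ξ) * t η = π (inner A ξ η)
  π_mul_t (a : A) (ξ : X) : π a * t ξ = t ((φ a).op ξ)

variable {φ : A →⋆ₙₐ[ℂ] Adj A X}

namespace Representation

variable {B : Type w} [NonUnitalCStarAlgebra B] {C : Type*} [NonUnitalCStarAlgebra C]

/-- `C⋆(π, t)`, the C⋆-subalgebra generated by the images of `π` and `t`. -/
def cstar (r : Representation φ B) : NonUnitalStarSubalgebra ℂ B :=
  (NonUnitalStarAlgebra.adjoin ℂ (Set.range r.π ∪ Set.range r.t)).topologicalClosure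

instance (r : Representation φ B) : IsClosed (r.cstar : Set B) :=
  NonUnitalStarSubalgebra.isClosed_topologicalClosure _

lemma π_mem (r : Representation φ B) (a : A) : r.π a ∈ r.cstar :=
  NonUnitalStarSubalgebra.le_topologicalClosure _
    (NonUnitalStarAlgebra.subset_adjoin ℂ _ (Or.inl ⟨a, rfl⟩))

lemma t_mem (r : Representation φ B) (ξ : X) : r.t ξ ∈ r.cstar :=
  NonUnitalStarSubalgebra.le_topologicalClosure _
    (NonUnitalStarAlgebra.subset_adjoin ℂ _ (Or.inr ⟨ξ, rfl⟩))

lemma norm_t_le (r : Representation φ B) (ξ : X) : ‖r.t ξ‖ ≤ ‖ξ‖ := by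
  refine le_of_sq_le_sq ?_ (norm_nonneg ξ)
  rw [norm_sq (A := A) ξ, pow_two, ← CStarRing.norm_star_mul_self, r.star_t_mul_t]
  exact NonUnitalStarAlgHom.norm_apply_le r.π _

lemma t_mul_π (r : Representation φ B) (ξ : X) (a : A) : r.t ξ * r.π a = r.t (ξ <• a) := by
  have h (η : X) : star (r.t η) * (r.t ξ * r.π a - r.t (ξ <• a)) = 0 := by
    rw [mul_sub, ← mul_assoc, r.star_t_mul_t, r.star_t_mul_t, HilbertModule.inner_act, map_mul,
      sub_self]
  have h' : star (r.t ξ * r.π a - r.t (ξ <• a)) * (r.t ξ * r.π a - r.t (ξ <• a)) = 0 := by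
    rw [star_sub, star_mul, sub_mul, mul_assoc, h, h, mul_zero, sub_self]
  rw [CStarRing.star_mul_self_eq_zero_iff] at h'
  exact sub_eq_zero.mp h'

/-- The graph of `ψ_t` over the linear span of the rank-one operators. -/
def psiGraph (r : Representation φ B) : NonUnitalStarSubalgebra ℂ (compacts A X × B) :=
  spanStar
    (Set.range fun p : X × X => ((thetaK A p.1 p.2, r.t p.1 * star (r.t p.2)) : compacts A X × B))
    (by
      rintro _ ⟨⟨ξ, η⟩, rfl⟩ _ ⟨⟨ξ', η'⟩, rfl⟩
      refine ⟨(ξ <• inner A η ξ', η'), Prod.ext (Subtype.ext ?_) ?_⟩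
      · exact (mul_theta (theta A ξ η) ξ' η').symm
      · change r.t (ξ <• inner A η ξ') * star (r.t η') =
          r.t ξ * star (r.t η) * (r.t ξ' * star (r.t η'))
        rw [← t_mul_π, ← r.star_t_mul_t]
        simp only [mul_assoc])
    (by
      rintro _ ⟨⟨ξ, η⟩, rfl⟩
      refine ⟨(η, ξ), Prod.ext (Subtype.ext ?_) ?_⟩
      · exact (star_theta ξ η).symm
      · change r.t η * star (r.t ξ) = star (r.t ξ * star (r.t η))
        rw [star_mul, star_star])

lemma psiGraph_mul_t (r : Representation φ B) {p : compacts A X × B} (hp : p ∈ r.psiGraph) :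
    ∀ ζ, p.2 * r.t ζ = r.t ((p.1 : Adj A X).op ζ) := by
  refine spanStar_induction (P := fun p : compacts A X × B =>
    ∀ ζ, p.2 * r.t ζ = r.t ((p.1 : Adj A X).op ζ)) ?_ ?_ ?_ ?_ hp
  · rintro _ ⟨⟨ξ, η⟩, rfl⟩ ζ
    change r.t ξ * star (r.t η) * r.t ζ = r.t (ξ <• inner A η ζ)
    rw [← t_mul_π, ← r.star_t_mul_t, mul_assoc]
  · intro ζ
    change 0 * r.t ζ = r.t 0
    rw [zero_mul, map_zero]
  · intro x y hx hy ζ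
    change (x.2 + y.2) * r.t ζ = r.t ((x.1 : Adj A X).op ζ + (y.1 : Adj A X).op ζ)
    rw [add_mul, hx, hy, map_add]
  · intro z x hx ζ
    change (z • x.2) * r.t ζ = r.t (z • (x.1 : Adj A X).op ζ)
    rw [smul_mul_assoc, hx, map_smul]

lemma psiGraph_bound (r : Representation φ B) {p : compacts A X × B} (hp : p ∈ r.psiGraph) :
    ∃ c : ℝ, ∀ (T : X →L[ℂ] X) (b : B), (∀ ζ, b * r.t ζ = r.t (T ζ)) → ‖b * p.2‖ ≤ c * ‖T‖ := by
  refine spanStar_induction (P := fun p : compacts A X × B => ∃ c : ℝ,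
    ∀ (T : X →L[ℂ] X) (b : B), (∀ ζ, b * r.t ζ = r.t (T ζ)) → ‖b * p.2‖ ≤ c * ‖T‖) ?_ ?_ ?_ ?_ hp
  · rintro _ ⟨⟨ξ, η⟩, rfl⟩
    refine ⟨‖ξ‖ * ‖η‖, fun T b hb => ?_⟩
    change ‖b * (r.t ξ * star (r.t η))‖ ≤ _
    rw [← mul_assoc, hb]
    refine (norm_mul_le _ _).trans ?_
    rw [norm_star]
    calc ‖r.t (T ξ)‖ * ‖r.t η‖ ≤ (‖T‖ * ‖ξ‖) * ‖η‖ := by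
          gcongr
          · exact (r.norm_t_le _).trans (T.le_opNorm ξ)
          · exact r.norm_t_le η
      _ = _ := by ring
  · refine ⟨0, fun T b _ => ?_⟩
    change ‖b * 0‖ ≤ _
    rw [mul_zero, norm_zero, zero_mul]
  · rintro x y ⟨c, hx⟩ ⟨d, hy⟩
    refine ⟨c + d, fun T b hb => ?_⟩
    change ‖b * (x.2 + y.2)‖ ≤ _
    rw [mul_add, add_mul]
    exact (norm_add_le _ _).trans (add_le_add (hx T b hb) (hy T b hb))
  · rintro z x ⟨c, hx⟩
    refine ⟨‖z‖ * c, fun T b hb => ?_⟩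
    change ‖b * (z • x.2)‖ ≤ _
    rw [mul_smul_comm, norm_smul, mul_assoc]
    exact mul_le_mul_of_nonneg_left (hx T b hb) (norm_nonneg z)

lemma psiGraph_iter (r : Representation φ B) {q : compacts A X × B} (hq : q ∈ r.psiGraph) (n : ℕ) :
    (iter q.1 n, iter q.2 n) ∈ r.psiGraph := by
  induction n with
  | zero => exact hq
  | succ n ih => exact r.psiGraph.mul_mem ih hq

lemma psiGraph_le (r : Representation φ B) (p : compacts A X × B) (hp : p ∈ r.psiGraph) :
    ‖p.2‖ ≤ ‖p.1‖ := by
  have hq : star p * p ∈ r.psiGraph := r.psiGraph.mul_mem (r.psiGraph.star_mem' hp) hp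
  obtain ⟨c, hc⟩ := r.psiGraph_bound hq
  have hc0 : c ≤ |c| := le_abs_self c
  have hsa : star (star p.2 * p.2) = star p.2 * p.2 := by rw [star_mul, star_star]
  have h : ‖star p.2 * p.2‖ ≤ ‖star p.1 * p.1‖ := by
    refine le_of_pow_le (c := |c|) (norm_nonneg _) fun k hk => ?_
    obtain ⟨n, hn⟩ : ∃ n, 2 ^ k - 1 = n + 1 := by
      refine ⟨2 ^ k - 2, ?_⟩
      have : 2 ^ 1 ≤ 2 ^ k := Nat.pow_le_pow_right (by norm_num) hk
      omega
    rw [← norm_iter hsa, hn]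
    refine (hc _ _ (r.psiGraph_mul_t (r.psiGraph_iter hq n))).trans ?_
    calc c * ‖iter (star p.1 * p.1) n‖ ≤ |c| * ‖iter (star p.1 * p.1) n‖ := by gcongr
      _ ≤ |c| * ‖star p.1 * p.1‖ ^ (n + 1) := by
        gcongr
        exact norm_iter_le _ n
  rw [CStarRing.norm_star_mul_self, CStarRing.norm_star_mul_self] at h
  exact abs_le_of_sq_le_sq' (by nlinarith) (norm_nonneg _) |>.2

variable (A X) in
lemma dense_finiteRank : Dense {k : compacts A X | (k : Adj A X) ∈ finiteRank A X} := by
  intro k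
  rw [closure_subtype]
  have hk : (k : Adj A X) ∈ closure (finiteRank A X : Set (Adj A X)) := k.2
  refine closure_mono ?_ hk
  intro T hT
  exact ⟨⟨T, (finiteRank A X).le_topologicalClosure hT⟩, hT, rfl⟩

lemma finiteRank_lift (r : Representation φ B) {T : Adj A X} (hT : T ∈ finiteRank A X) :
    ∃ p ∈ r.psiGraph, (p.1 : Adj A X) = T := by
  rw [mem_finiteRank] at hT
  induction hT using Submodule.span_induction with
  | mem T h =>
    obtain ⟨⟨ξ, η⟩, rfl⟩ := h
    exact ⟨(thetaK A ξ η, r.t ξ * star (r.t η)), Submodule.subset_span ⟨(ξ, η), rfl⟩, rfl⟩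
  | zero => exact ⟨0, r.psiGraph.zero_mem, rfl⟩
  | add x y _ _ hx hy =>
    obtain ⟨p, hp, rfl⟩ := hx
    obtain ⟨q, hq, rfl⟩ := hy
    exact ⟨p + q, r.psiGraph.add_mem hp hq, rfl⟩
  | smul z x _ hx =>
    obtain ⟨p, hp, rfl⟩ := hx
    exact ⟨z • p, SMulMemClass.smul_mem z hp, rfl⟩

/-- There is one and only one ⋆-homomorphism `𝓚(X) → B` which maps `θ_{ξ,η}` to `t(ξ) t(η)⋆`. -/
theorem existsUnique_psi (r : Representation φ B) :
    ∃! ψ : compacts A X →⋆ₙₐ[ℂ] B, ∀ ξ η : X, ψ (thetaK A ξ η) = r.t ξ * star (r.t η) := by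
  obtain ⟨ψ, hψ⟩ := exists_hom r.psiGraph r.psiGraph_le
    ((dense_finiteRank A X).mono fun k hk => by
      obtain ⟨p, hp, h⟩ := r.finiteRank_lift hk
      exact ⟨p, hp, Subtype.ext h⟩)
  refine ⟨ψ, fun ξ η => hψ (_, _) (Submodule.subset_span ⟨(ξ, η), rfl⟩), fun ψ' h' => ?_⟩
  have hψ' : ∀ p ∈ r.psiGraph, ψ' p.1 = p.2 := by
    intro p hp
    refine spanStar_induction (P := fun p : compacts A X × B => ψ' p.1 = p.2) ?_ ?_ ?_ ?_ hp
    · rintro _ ⟨⟨ξ, η⟩, rfl⟩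
      exact h' ξ η
    · exact map_zero ψ'
    · intro x y hx hy
      change ψ' (x.1 + y.1) = x.2 + y.2
      rw [map_add, hx, hy]
    · intro z x hx
      change ψ' (z • x.1) = z • x.2
      rw [map_smul, hx]
  refine DFunLike.coe_injective (Continuous.ext_on (dense_finiteRank A X)
    (hom_continuous ψ') (hom_continuous ψ) fun k hk => ?_)
  obtain ⟨p, hp, h⟩ := r.finiteRank_lift hk
  obtain rfl : p.1 = k := Subtype.ext h
  rw [hψ p hp, hψ' p hp]

/-- The ⋆-homomorphism `ψ_t : 𝓚(X) → B` with `ψ_t(θ_{ξ,η}) = t(ξ) t(η)⋆`. -/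
def psi (r : Representation φ B) : compacts A X →⋆ₙₐ[ℂ] B := r.existsUnique_psi.choose

lemma psi_thetaK (r : Representation φ B) (ξ η : X) :
    r.psi (thetaK A ξ η) = r.t ξ * star (r.t η) := r.existsUnique_psi.choose_spec.1 ξ η

lemma eq_psi (r : Representation φ B) {ψ : compacts A X →⋆ₙₐ[ℂ] B}
    (h : ∀ ξ η : X, ψ (thetaK A ξ η) = r.t ξ * star (r.t η)) : ψ = r.psi :=
  r.existsUnique_psi.choose_spec.2 ψ h

/-- Push a representation forward along a ⋆-homomorphism. -/
def map (r : Representation φ B) (ρ : B →⋆ₙₐ[ℂ] C) : Representation φ C where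
  π := ρ.comp r.π
  t := (ρ : B →ₗ[ℂ] C).comp r.t
  star_t_mul_t ξ η := by
    change star (ρ (r.t ξ)) * ρ (r.t η) = ρ (r.π (inner A ξ η))
    rw [← map_star, ← map_mul, r.star_t_mul_t]
  π_mul_t a ξ := by
    change ρ (r.π a) * ρ (r.t ξ) = ρ (r.t ((φ a).op ξ))
    rw [← map_mul, r.π_mul_t]

lemma psi_map (r : Representation φ B) (ρ : B →⋆ₙₐ[ℂ] C) : ρ.comp r.psi = (r.map ρ).psi := by
  refine eq_psi _ fun ξ η => ?_
  change ρ (r.psi (thetaK A ξ η)) = ρ (r.t ξ) * star (ρ (r.t η))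
  rw [psi_thetaK, map_mul, map_star]

end Representation

/-- The annihilator `I^⊥ = {a | a b = 0 for all b ∈ I}` of `I ⊆ A`. -/
def perp (I : Set A) : Set A := {a | ∀ b ∈ I, a * b = 0}

variable (φ) in
/-- The ideal `J_X = φ⁻¹(𝓚(X)) ∩ (ker φ)^⊥` of `A`. -/
def idealJ : Set A := {a | φ a ∈ compacts A X} ∩ perp {a | φ a = 0}

/-- Condition (∗), covariance: `π(a) = ψ_t(φ(a))` for all `a ∈ J_X`. -/
def Representation.IsCovariant {B : Type w} [NonUnitalCStarAlgebra B] (r : Representation φ B) :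
    Prop :=
  ∀ (a : A) (ha : a ∈ idealJ φ), r.π a = r.psi ⟨φ a, ha.1⟩

/-- `r` is a universal covariant representation of the correspondence: it is covariant, it generates
the C⋆-algebra `O` on which it is given, and every covariant representation factors through it by a
unique ⋆-homomorphism. -/
structure Representation.IsUniversal {O : Type (max u v)} [NonUnitalCStarAlgebra O]
    (r : Representation φ O) : Prop where
  isCovariant : r.IsCovariant
  cstar_eq_top : r.cstar = ⊤
  existsUnique_hom (B : Type (max u v)) [NonUnitalCStarAlgebra B] (s : Representation φ B)
    (hs : s.IsCovariant) :
    ∃! ρ : O →⋆ₙₐ[ℂ] B, (∀ a, ρ (r.π a) = s.π a) ∧ ∀ ξ, ρ (r.t ξ) = s.t ξ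

variable (A X) in
/-- Formal ⋆-polynomials without constant term in the elements of `A` and of `X`. -/
inductive Word : Type (max u v)
  | ofA (a : A) : Word
  | ofX (ξ : X) : Word
  | add (p q : Word) : Word
  | mul (p q : Word) : Word
  | smul (z : ℂ) (p : Word) : Word
  | star (p : Word) : Word

namespace Representation

variable {B : Type w} [NonUnitalCStarAlgebra B] {C : Type*} [NonUnitalCStarAlgebra C]

/-- The value of a ⋆-polynomial in a representation. -/
def eval (r : Representation φ B) : Word A X → B
  | .ofA a => r.π a
  | .ofX ξ => r.t ξ
  | .add p q => r.eval p + r.eval q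
  | .mul p q => r.eval p * r.eval q
  | .smul z p => z • r.eval p
  | .star p => star (r.eval p)

lemma eval_map (r : Representation φ B) (ρ : B →⋆ₙₐ[ℂ] C) (p : Word A X) :
    (r.map ρ).eval p = ρ (r.eval p) := by
  induction p with
  | ofA a => rfl
  | ofX ξ => rfl
  | add p q hp hq => simp only [eval, hp, hq, map_add]
  | mul p q hp hq => simp only [eval, hp, hq, map_mul]
  | smul z p hp => simp only [eval, hp, map_smul]
  | star p hp => simp only [eval, hp, map_star]

/-- The pairs of values of the ⋆-polynomials in two representations. -/
def evalGraph (r : Representation φ B) (s : Representation φ C) :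
    NonUnitalStarSubalgebra ℂ (B × C) where
  carrier := Set.range fun p : Word A X => (r.eval p, s.eval p)
  add_mem' := by
    rintro _ _ ⟨p, rfl⟩ ⟨q, rfl⟩
    exact ⟨.add p q, rfl⟩
  mul_mem' := by
    rintro _ _ ⟨p, rfl⟩ ⟨q, rfl⟩
    exact ⟨.mul p q, rfl⟩
  zero_mem' := ⟨.ofA 0, Prod.ext (map_zero r.π) (map_zero s.π)⟩
  smul_mem' := by
    rintro z _ ⟨p, rfl⟩
    exact ⟨.smul z p, rfl⟩
  star_mem' := by
    rintro _ ⟨p, rfl⟩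
    exact ⟨.star p, rfl⟩

lemma dense_eval (r : Representation φ B) (hr : r.cstar = ⊤) (s : Representation φ C) :
    Dense (Prod.fst '' (r.evalGraph s : Set (B × C))) := by
  have h : NonUnitalStarAlgebra.adjoin ℂ (Set.range r.π ∪ Set.range r.t) ≤
      (r.evalGraph s).map (NonUnitalStarAlgHom.fst ℂ B C) := by
    refine NonUnitalStarAlgebra.adjoin_le ?_
    rintro _ (⟨a, rfl⟩ | ⟨ξ, rfl⟩)
    · exact ⟨_, ⟨.ofA a, rfl⟩, rfl⟩
    · exact ⟨_, ⟨.ofX ξ, rfl⟩, rfl⟩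
  intro b
  have hb : b ∈ r.cstar := by rw [hr]; exact NonUnitalStarAlgebra.mem_top
  exact closure_mono h hb

lemma exists_hom_of_eval_le (r : Representation φ B) (hr : r.cstar = ⊤) (s : Representation φ C)
    (h : ∀ p, ‖s.eval p‖ ≤ ‖r.eval p‖) :
    ∃! ρ : B →⋆ₙₐ[ℂ] C, (∀ a, ρ (r.π a) = s.π a) ∧ ∀ ξ, ρ (r.t ξ) = s.t ξ := by
  obtain ⟨ρ, hρ⟩ := exists_hom (r.evalGraph s) (by rintro _ ⟨p, rfl⟩; exact h p)
    (r.dense_eval hr s)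
  have h1 : ∀ a, ρ (r.π a) = s.π a := fun a => hρ (_, _) ⟨.ofA a, rfl⟩
  have h2 : ∀ ξ, ρ (r.t ξ) = s.t ξ := fun ξ => hρ (_, _) ⟨.ofX ξ, rfl⟩
  refine ⟨ρ, ⟨h1, h2⟩, fun σ hσ => hom_ext (Set.range r.π ∪ Set.range r.t) hr ?_⟩
  rintro _ (⟨a, rfl⟩ | ⟨ξ, rfl⟩)
  · rw [hσ.1, h1]
  · rw [hσ.2, h2]

/-- Restrict a representation to the C⋆-algebra which it generates. -/
def restrict (r : Representation φ B) : Representation φ r.cstar where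
  π := NonUnitalStarAlgHom.codRestrict r.π r.cstar r.π_mem
  t := r.t.codRestrict r.cstar.toSubmodule r.t_mem
  star_t_mul_t ξ η := Subtype.ext (r.star_t_mul_t ξ η)
  π_mul_t a ξ := Subtype.ext (r.π_mul_t a ξ)

lemma restrict_map (r : Representation φ B) :
    r.restrict.map (NonUnitalStarSubalgebraClass.subtype r.cstar) = r := rfl

lemma restrict_isCovariant (r : Representation φ B) (hr : r.IsCovariant) :
    r.restrict.IsCovariant := by
  intro a ha
  refine Subtype.ext ?_
  have h := DFunLike.congr_fun
    (r.restrict.psi_map (NonUnitalStarSubalgebraClass.subtype r.cstar)) ⟨φ a, ha.1⟩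
  exact (hr a ha).trans h.symm

lemma restrict_cstar (r : Representation φ B) : r.restrict.cstar = ⊤ := by
  have key : NonUnitalStarAlgebra.adjoin ℂ (Set.range r.π ∪ Set.range r.t) ≤
      (NonUnitalStarAlgebra.adjoin ℂ (Set.range r.restrict.π ∪ Set.range r.restrict.t)).map
        (NonUnitalStarSubalgebraClass.subtype r.cstar) := by
    refine NonUnitalStarAlgebra.adjoin_le ?_
    rintro _ (⟨a, rfl⟩ | ⟨ξ, rfl⟩)
    · exact ⟨_, NonUnitalStarAlgebra.subset_adjoin ℂ _ (Or.inl ⟨a, rfl⟩), rfl⟩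
    · exact ⟨_, NonUnitalStarAlgebra.subset_adjoin ℂ _ (Or.inr ⟨ξ, rfl⟩), rfl⟩
  rw [NonUnitalStarAlgebra.eq_top_iff]
  intro x
  change x ∈ closure _
  rw [closure_subtype]
  exact closure_mono key x.2

end Representation

variable (φ) in
/-- The norms on ⋆-polynomials which come from covariant representations. They form a set that
indexes, up to isomorphism, the C⋆-algebras generated by covariant representations. -/
def NormIndex : Type (max u v) :=
  {N : Word A X → ℝ // ∃ (B : Type (max u v)) (_ : NonUnitalCStarAlgebra B)
    (r : Representation φ B), r.IsCovariant ∧ ∀ p, N p = ‖r.eval p‖}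

namespace NormIndex

/-- The C⋆-algebra of a covariant representation with the given norm. -/
def Alg (N : NormIndex φ) : Type (max u v) := N.2.choose

instance (N : NormIndex φ) : NonUnitalCStarAlgebra N.Alg := N.2.choose_spec.choose

/-- A covariant representation with the given norm. -/
def rep (N : NormIndex φ) : Representation φ N.Alg := N.2.choose_spec.choose_spec.choose

lemma rep_isCovariant (N : NormIndex φ) : N.rep.IsCovariant :=
  N.2.choose_spec.choose_spec.choose_spec.1

lemma norm_eval_rep (N : NormIndex φ) (p : Word A X) : ‖N.rep.eval p‖ = N.1 p :=
  (N.2.choose_spec.choose_spec.choose_spec.2 p).symm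

end NormIndex

variable (φ) in
/-- The direct sum, over all norms in `NormIndex φ`, of the chosen covariant representations. -/
def sumRep : Representation φ (lp (fun N : NormIndex φ => N.Alg) ∞) where
  π :=
    { toFun := fun a => ⟨fun N => N.rep.π a, memℓp_infty ⟨‖a‖, by
        rintro _ ⟨N, rfl⟩
        exact NonUnitalStarAlgHom.norm_apply_le N.rep.π a⟩⟩
      map_smul' := fun z a => Subtype.ext (funext fun N => map_smul N.rep.π z a)
      map_zero' := Subtype.ext (funext fun N => map_zero N.rep.π)
      map_add' := fun a b => Subtype.ext (funext fun N => map_add N.rep.π a b)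
      map_mul' := fun a b => Subtype.ext (funext fun N => map_mul N.rep.π a b)
      map_star' := fun a => Subtype.ext (funext fun N => map_star N.rep.π a) }
  t :=
    { toFun := fun ξ => ⟨fun N => N.rep.t ξ, memℓp_infty ⟨‖ξ‖, by
        rintro _ ⟨N, rfl⟩
        exact N.rep.norm_t_le ξ⟩⟩
      map_add' := fun ξ η => Subtype.ext (funext fun N => map_add N.rep.t ξ η)
      map_smul' := fun z ξ => Subtype.ext (funext fun N => map_smul N.rep.t z ξ) }
  star_t_mul_t ξ η := Subtype.ext (funext fun N => N.rep.star_t_mul_t ξ η)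
  π_mul_t a ξ := Subtype.ext (funext fun N => N.rep.π_mul_t a ξ)

/-- The projection of the direct sum onto one of its summands. -/
def coord (N : NormIndex φ) : lp (fun N : NormIndex φ => N.Alg) ∞ →⋆ₙₐ[ℂ] N.Alg where
  toFun x := x N
  map_smul' _ _ := rfl
  map_zero' := rfl
  map_add' _ _ := rfl
  map_mul' _ _ := rfl
  map_star' _ := rfl

lemma sumRep_map (N : NormIndex φ) : (sumRep φ).map (coord N) = N.rep := rfl

lemma sumRep_isCovariant : (sumRep φ).IsCovariant := by
  intro a ha
  refine Subtype.ext (funext fun N => ?_)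
  have h := DFunLike.congr_fun ((sumRep φ).psi_map (coord N)) ⟨φ a, ha.1⟩
  exact (N.rep_isCovariant a ha).trans h.symm

lemma norm_eval_le {B : Type (max u v)} [NonUnitalCStarAlgebra B] (s : Representation φ B)
    (hs : s.IsCovariant) (p : Word A X) : ‖s.eval p‖ ≤ ‖(sumRep φ).eval p‖ := by
  let N : NormIndex φ := ⟨fun p => ‖s.eval p‖, B, _, s, hs, fun _ => rfl⟩
  have h1 : ‖s.eval p‖ = ‖N.rep.eval p‖ := (N.norm_eval_rep p).symm
  rw [h1, ← sumRep_map N, Representation.eval_map]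
  exact NonUnitalStarAlgHom.norm_apply_le _ _

variable (φ) in
/-- The C⋆-algebra `𝓞_X = C⋆(π_X, t_X)`. -/
def OX : Type (max u v) := (sumRep φ).cstar

instance : NonUnitalCStarAlgebra (OX φ) :=
  inferInstanceAs (NonUnitalCStarAlgebra (sumRep φ).cstar)

variable (φ) in
/-- The representation `(π_X, t_X)` on `𝓞_X`. -/
def universalRep : Representation φ (OX φ) := (sumRep φ).restrict

variable (φ) in
/-- `(π_X, t_X)` is the universal covariant representation. -/
theorem universalRep_isUniversal : (universalRep φ).IsUniversal where
  isCovariant := (sumRep φ).restrict_isCovariant sumRep_isCovariant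
  cstar_eq_top := (sumRep φ).restrict_cstar
  existsUnique_hom B _ s hs := by
    refine Representation.exists_hom_of_eval_le _ (sumRep φ).restrict_cstar s fun p => ?_
    refine (norm_eval_le s hs p).trans_eq ?_
    have h := (sumRep φ).restrict.eval_map
      (NonUnitalStarSubalgebraClass.subtype (sumRep φ).cstar) p
    rw [Representation.restrict_map] at h
    rw [h]
    rfl

end Correspondence

end

end CStarCorr

/-! The universal covariant representation dominates every covariant representation. So if some
covariant representation is injective on `A`, then `π_X` is injective, hence isometric, and `t_X` is
isometric because ‖t(ξ)‖² = ‖π(⟨ξ,ξ⟩)‖. Everything below constructs one injective covariant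
representation.

Let `A` act faithfully on a Hilbert space H₀ and put Hₙ₊₁ = (X ⊕ ker φ) ⊗_A Hₙ, where `A` acts by
`φ` on `X` and by multiplication on ker φ. This action is again faithful, because an element of ker
φ that annihilates ker φ is 0. Elements of `J_X` annihilate ker φ, so on Hₙ₊₁ they act through `φ`
and the action of 𝓛(X) on the summand X ⊗ Hₙ. There θ_{ξ,η} acts as T_ξ T_η*, with T_ξ : Hₙ → Hₙ₊₁
the creation operator (`exists_step`).

On sequences (hₙ), let `A` act termwise and let t(ξ) apply T_ξ and raise the index. Covariance then
holds at every index except 0, which no step reaches. The defect disappears when the inner product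
is the Banach limit of ⟨gₙ, hₙ⟩ (`exists_banachLimit`, `exists_limit_representation`): a Banach
limit does not see single terms, and its shift invariance gives t(ξ)*t(η) = π(⟨ξ,η⟩). Injectivity
survives because every πₙ is isometric, so that ‖πₙ(a)xₙ‖ > ‖a‖/2 can be achieved at all n
simultaneously. -/

namespace CStarCorr

open scoped ENNReal RightActions

noncomputable section

universe u v w

/-! ### Completions of semi-inner product spaces and actions on them -/

section Hilbert

/-- The Hilbert space completion of a semi-inner product space. -/
theorem exists_completion {V : Type u} [AddCommGroup V] [Module ℂ V]
    (c : PreInnerProductSpace.Core ℂ V) :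
    ∃ (H : Type u) (_ : NormedAddCommGroup H) (_ : InnerProductSpace ℂ H) (_ : CompleteSpace H)
      (ι : V →ₗ[ℂ] H), DenseRange ι ∧ ∀ v w, inner ℂ (ι v) (ι w) = c.inner v w := by
  letI : SeminormedAddCommGroup V := InnerProductSpace.Core.toSeminormedAddCommGroup (c := c)
  letI : InnerProductSpace ℂ V := InnerProductSpace.ofCore c
  refine ⟨UniformSpace.Completion V, inferInstance, inferInstance, inferInstance,
    (UniformSpace.Completion.toComplL (𝕜 := ℂ) (E := V) : V →ₗ[ℂ] UniformSpace.Completion V),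
    UniformSpace.Completion.denseRange_coe, fun v w => ?_⟩
  exact UniformSpace.Completion.inner_coe v w

/-- `1 - x` has a square root of the form `1 - b` if `x` is a positive contraction. -/
lemma exists_quasi_sqrt {E : Type*} [NonUnitalCStarAlgebra E] (x : E) (hx : ‖x‖ ≤ 1) :
    ∃ b : E, star b = b ∧ star x * x = b + b - b * b := by
  letI : PartialOrder E := CStarAlgebra.spectralOrder E
  haveI : StarOrderedRing E := CStarAlgebra.spectralOrderedRing E
  have hsa : IsSelfAdjoint (star x * x) := IsSelfAdjoint.star_mul_self x
  -- On the spectrum 1 - r ≥ 0, so `√(1 - r)` is a true square root there.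
  have hle : ∀ r ∈ quasispectrum ℝ (star x * x), r ≤ 1 := fun r hr => by
    have h1 := NonUnitalIsometricContinuousFunctionalCalculus.norm_quasispectrum_le _ hr hsa
    rw [CStarRing.norm_star_mul_self] at h1
    exact (le_abs_self r).trans (h1.trans (mul_le_one₀ hx (norm_nonneg x) hx))
  -- Solving (1 - b)² = 1 - x*x formally. The function vanishes at 0, so no unit is needed.
  refine ⟨cfcₙ (fun r : ℝ => 1 - √(1 - r)) (star x * x), ?_, ?_⟩
  · exact IsSelfAdjoint.star_eq (cfcₙ_predicate _ _)
  · rw [← cfcₙ_mul _ _ _, ← cfcₙ_add _ _ _, ← cfcₙ_sub _ _ _]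
    conv_lhs => rw [← cfcₙ_id ℝ (star x * x)]
    refine cfcₙ_congr fun r hr => ?_
    have := Real.mul_self_sqrt (sub_nonneg.mpr (hle r hr))
    simp only [id]
    linear_combination this

variable {V : Type*} [AddCommGroup V] [Module ℂ V] {H : Type*} [NormedAddCommGroup H]
  [InnerProductSpace ℂ H] {ι : V →ₗ[ℂ] H}

lemma eq_of_inner_dense (hι : DenseRange ι) {x y : H}
    (h : ∀ v, inner ℂ (ι v) x = inner ℂ (ι v) y) : x = y := by
  refine ext_inner_left ℂ fun z => ?_
  exact hι.induction_on z (isClosed_eq (by fun_prop) (by fun_prop)) h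

lemma clm_ext_dense (hι : DenseRange ι) {H' : Type*} [NormedAddCommGroup H'] [NormedSpace ℂ H']
    {S T : H →L[ℂ] H'} (h : ∀ v, S (ι v) = T (ι v)) : S = T :=
  DFunLike.coe_injective (hι.equalizer S.continuous T.continuous (funext h))

/-- Algebraic actions of C⋆-algebras by formally adjointable maps are contractive. -/
lemma norm_action_le {E : Type*} [NonUnitalCStarAlgebra E] (ρ : E → V →ₗ[ℂ] V)
    (hstar : ∀ x v w, inner ℂ (ι (ρ x v)) (ι w) = inner ℂ (ι v) (ι (ρ (star x) w)))
    (hadd : ∀ x y v, ι (ρ (x + y) v) = ι (ρ x v) + ι (ρ y v))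
    (hsmul : ∀ (z : ℂ) x v, ι (ρ (z • x) v) = z • ι (ρ x v))
    (hmul : ∀ x y v, ι (ρ (x * y) v) = ι (ρ x (ρ y v))) (x : E) (v : V) :
    ‖ι (ρ x v)‖ ≤ ‖x‖ * ‖ι v‖ := by
  have key : ∀ x : E, ‖x‖ ≤ 1 → ‖ι (ρ x v)‖ ≤ ‖ι v‖ := by
    intro x hx
    obtain ⟨b, hb, hxb⟩ := exists_quasi_sqrt x hx
    have hsub : ι (ρ (b + b - b * b) v) = ι (ρ b v) + ι (ρ b v) - ι (ρ b (ρ b v)) := by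
      have : b + b - b * b = b + b + (-1 : ℂ) • (b * b) := by rw [neg_one_smul, sub_eq_add_neg]
      rw [this, hadd, hadd, hsmul, hmul, neg_one_smul, sub_eq_add_neg]
    have h1 : inner ℂ (ι (ρ x v)) (ι (ρ x v)) =
        inner ℂ (ι v) (ι (ρ b v)) + inner ℂ (ι v) (ι (ρ b v)) -
          inner ℂ (ι (ρ b v)) (ι (ρ b v)) := by
      have h2 := hstar b v (ρ b v)
      rw [hb] at h2
      rw [hstar, ← hmul, hxb, hsub, _root_.inner_sub_right, inner_add_right, h2]
    have h3 : inner ℂ (ι (ρ b v)) (ι v) = inner ℂ (ι v) (ι (ρ b v)) := by rw [hstar, hb]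
    -- This is ‖(1 - b)v‖² = ‖v‖² - ‖xv‖², and positivity of the left side gives the contraction.
    have h4 : inner ℂ (ι v - ι (ρ b v)) (ι v - ι (ρ b v)) =
        inner ℂ (ι v) (ι v) - inner ℂ (ι (ρ x v)) (ι (ρ x v)) := by
      rw [h1, _root_.inner_sub_left, _root_.inner_sub_right, _root_.inner_sub_right, h3]
      ring
    rw [inner_self_eq_norm_sq_to_K, inner_self_eq_norm_sq_to_K, inner_self_eq_norm_sq_to_K] at h4
    have h5 : ‖ι v - ι (ρ b v)‖ ^ 2 = ‖ι v‖ ^ 2 - ‖ι (ρ x v)‖ ^ 2 := by exact_mod_cast h4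
    exact le_of_sq_le_sq (by nlinarith [sq_nonneg ‖ι v - ι (ρ b v)‖]) (norm_nonneg _)
  rcases eq_or_ne x 0 with rfl | hx
  · have := hsmul 0 0 v
    rw [zero_smul, zero_smul] at this
    rw [this, norm_zero, norm_zero, zero_mul]
  · have hx' : 0 < ‖x‖ := norm_pos_iff.mpr hx
    have h1 := key ((‖x‖⁻¹ : ℂ) • x) (by
      rw [norm_smul, norm_inv, Complex.norm_real, norm_norm, inv_mul_cancel₀ hx'.ne'])
    rw [hsmul, norm_smul, norm_inv, Complex.norm_real, norm_norm, inv_mul_le_iff₀ hx'] at h1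
    exact h1

/-- Algebraic actions of C⋆-algebras by formally adjointable maps extend to the completion. -/
theorem exists_starHom [CompleteSpace H] (hι : DenseRange ι) {E : Type*} [NonUnitalCStarAlgebra E]
    (ρ : E → V →ₗ[ℂ] V)
    (hstar : ∀ x v w, inner ℂ (ι (ρ x v)) (ι w) = inner ℂ (ι v) (ι (ρ (star x) w)))
    (hadd : ∀ x y v, ι (ρ (x + y) v) = ι (ρ x v) + ι (ρ y v))
    (hsmul : ∀ (z : ℂ) x v, ι (ρ (z • x) v) = z • ι (ρ x v))
    (hmul : ∀ x y v, ι (ρ (x * y) v) = ι (ρ x (ρ y v))) :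
    ∃ π : E →⋆ₙₐ[ℂ] (H →L[ℂ] H), ∀ x v, π x (ι v) = ι (ρ x v) := by
  -- By the norm bound, vectors killed by `ι` stay killed, so the operators descend and extend by
  -- continuity.
  let P : E → H →L[ℂ] H := fun x => (ι.comp (ρ x)).extendOfNorm ι
  have hP : ∀ x v, P x (ι v) = ι (ρ x v) := fun x v =>
    LinearMap.extendOfNorm_eq hι ⟨‖x‖, norm_action_le ρ hstar hadd hsmul hmul x⟩ v
  have hPs : ∀ (z : ℂ) x, P (z • x) = z • P x := fun z x => clm_ext_dense hι fun v => by
    rw [_root_.smul_apply, hP, hP, hsmul]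
  refine ⟨{ toFun := P, map_smul' := hPs, map_zero' := ?_, map_add' := ?_, map_mul' := ?_,
            map_star' := ?_ }, hP⟩
  · have := hPs 0 0
    rwa [zero_smul, zero_smul] at this
  · exact fun x y => clm_ext_dense hι fun v => by
      rw [_root_.add_apply, hP, hP, hP, hadd]
  · exact fun x y => clm_ext_dense hι fun v => by
      rw [mul_apply_eq_comp, hP, hP, hP, hmul]
  · refine fun x => clm_ext_dense hι fun w => eq_of_inner_dense hι fun v => ?_
    rw [ContinuousLinearMap.star_eq_adjoint, ContinuousLinearMap.adjoint_inner_right, hP, hP, hstar]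

end Hilbert

/-! ### Positive functionals and a faithful representation -/

section Faithful

open scoped ComplexOrder

variable {A : Type u} [NonUnitalCStarAlgebra A] [PartialOrder A] [StarOrderedRing A]

lemma eq_zero_of_nonneg_of_neg_nonneg {a : A} (h : 0 ≤ a) (h' : 0 ≤ -a) : a = 0 :=
  le_antisymm (neg_nonneg.mp h') h

/-- Positive functionals separate the points of a C⋆-algebra. -/
theorem exists_positive_ne_zero {a : A} (ha : 0 ≤ a) (ha0 : a ≠ 0) :
    ∃ f : A →ₚ[ℂ] ℂ, f a ≠ 0 := by
  let C : ProperCone ℝ A :=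
    { carrier := {x | 0 ≤ x}
      add_mem' := fun hx hy => add_nonneg hx hy
      zero_mem' := le_refl (0 : A)
      smul_mem' := fun r x hx => by
        have : (0 : A) ≤ (r : ℝ) • x := smul_nonneg r.2 hx
        exact this
      isClosed' := CStarAlgebra.isClosed_nonneg }
  have haC : -a ∉ C := fun h => ha0 (eq_zero_of_nonneg_of_neg_nonneg ha h)
  obtain ⟨f, hf, hfa⟩ := C.hyperplane_separation_point haC
  -- The separating functional is only real-linear. Symmetrized, it vanishes on i times self-adjoint
  -- elements, so its complexification is real on positive elements, where it equals 2f.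
  let fr : Module.Dual ℝ A :=
    { toFun := fun x => f (x + star x)
      map_add' := fun x y => by rw [← map_add, star_add]; congr 1; abel
      map_smul' := fun r x => by
        rw [star_smul, star_trivial, ← smul_add, map_smul]; rfl }
  have hpos : ∀ x : A, 0 ≤ x → (fr.extendRCLike : Module.Dual ℂ A) x = (2 * f x : ℝ) := by
    intro x hx
    have hs : star x = x := (IsSelfAdjoint.of_nonneg hx).star_eq
    have h1 : fr x = 2 * f x := by
      change f (x + star x) = _
      rw [hs, ← two_smul ℝ x, map_smul, smul_eq_mul]
    have h2 : fr ((RCLike.I : ℂ) • x) = 0 := by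
      change f ((RCLike.I : ℂ) • x + star ((RCLike.I : ℂ) • x)) = 0
      rw [star_smul, hs, ← add_smul]
      simp
    rw [Module.Dual.extendRCLike_apply, h1, h2]
    simp
  refine ⟨PositiveLinearMap.mk₀ fr.extendRCLike fun x hx => ?_, fun h => ?_⟩
  · rw [hpos x hx]
    have := hf x hx
    exact_mod_cast (by positivity)
  · change (fr.extendRCLike : Module.Dual ℂ A) a = 0 at h
    rw [hpos a ha] at h
    have h3 : 2 * f a = 0 := by exact_mod_cast h
    rw [map_neg] at hfa
    linarith

/-- Every C⋆-algebra has a faithful representation on a Hilbert space. -/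
theorem exists_faithful (A : Type u) [NonUnitalCStarAlgebra A] [PartialOrder A]
    [StarOrderedRing A] :
    ∃ (H : Type (max u v)) (_ : NormedAddCommGroup H) (_ : InnerProductSpace ℂ H)
      (_ : CompleteSpace H) (π : A →⋆ₙₐ[ℂ] (H →L[ℂ] H)), Function.Injective π := by
  -- The algebraic direct sum of the GNS spaces of all positive functionals; the factor `PUnit` only
  -- raises the universe to that of the later spaces.
  let V := (A →ₚ[ℂ] ℂ) × PUnit.{v + 1} →₀ A
  let B : V → V → ℂ := fun x y => x.sum fun p a => p.1 (star a * y p)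
  have hBs : ∀ x y : V, ∀ s, x.support ⊆ s → B x y = ∑ p ∈ s, p.1 (star (x p) * y p) :=
    fun x y s hs => Finsupp.sum_of_support_subset x hs _ (by simp)
  classical
  let c : PreInnerProductSpace.Core ℂ V :=
    { inner := B
      conj_inner_symm := fun x y => by
        rw [hBs x y (x.support ∪ y.support) Finset.subset_union_left,
          hBs y x (x.support ∪ y.support) Finset.subset_union_right, map_sum]
        refine Finset.sum_congr rfl fun p _ => ?_
        rw [← Complex.star_def, ← map_star, star_mul, star_star]
      re_inner_nonneg := fun x => by
        rw [hBs x x x.support subset_rfl, map_sum]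
        exact Finset.sum_nonneg fun p _ =>
          (RCLike.nonneg_iff.mp (p.1.map_nonneg (star_mul_self_nonneg (x p)))).1
      add_left := fun x y z => by
        refine Finsupp.sum_add_index' (by simp) fun p a b => ?_
        rw [star_add, add_mul, map_add]
      smul_left := fun x y r => by
        change B (r • x) y = _ * B x y
        rw [hBs (r • x) y x.support Finsupp.support_smul, hBs x y x.support subset_rfl,
          Finset.mul_sum]
        refine Finset.sum_congr rfl fun p _ => ?_
        rw [Finsupp.smul_apply, star_smul, smul_mul_assoc, map_smul]
        rfl }
  obtain ⟨H, i1, i2, i3, ι, hι, hin⟩ := exists_completion c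
  have hin' : ∀ v w, inner ℂ (ι v) (ι w) = B v w := hin
  let ρ : A → V →ₗ[ℂ] V := fun a => Finsupp.mapRange.linearMap (LinearMap.mulLeft ℂ a)
  have hρ : ∀ a (x : V) p, ρ a x p = a * x p := fun a x p => rfl
  obtain ⟨π, hπ⟩ := exists_starHom hι ρ
    (fun a x y => by
      rw [hin', hin', hBs (ρ a x) y x.support (Finsupp.support_mapRange (hf := mul_zero a)),
        hBs x _ x.support subset_rfl]
      refine Finset.sum_congr rfl fun p _ => ?_
      rw [hρ, hρ, star_mul, mul_assoc])
    (fun a b x => by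
      rw [← map_add]
      congr 1
      ext p
      rw [Finsupp.add_apply, hρ, hρ, hρ, add_mul])
    (fun z a x => by
      rw [← map_smul]
      congr 1
      ext p
      rw [Finsupp.smul_apply, hρ, hρ, smul_mul_assoc])
    (fun a b x => by
      congr 1
      ext p
      rw [hρ, hρ, hρ, mul_assoc])
  refine ⟨H, i1, i2, i3, π, (injective_iff_map_eq_zero π).mpr fun a ha => ?_⟩
  by_contra ha0
  -- Without a unit, the vector a* in the summand of f replaces the cyclic vector: its image under a
  -- has squared norm f((aa*)*(aa*)), and f is chosen nonzero there.
  have h1 : a * star a ≠ 0 := fun h => ha0 (CStarRing.mul_star_self_eq_zero_iff a |>.mp h)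
  have h2 : star (a * star a) * (a * star a) ≠ 0 := fun h =>
    h1 (CStarRing.star_mul_self_eq_zero_iff _ |>.mp h)
  obtain ⟨f, hf⟩ := exists_positive_ne_zero (star_mul_self_nonneg (a * star a)) h2
  have h3 : ι (ρ a (Finsupp.single (f, PUnit.unit) (star a))) = 0 := by
    rw [← hπ, ha, _root_.zero_apply]
  have h4 := hin' (ρ a (Finsupp.single (f, PUnit.unit) (star a)))
    (ρ a (Finsupp.single (f, PUnit.unit) (star a)))
  rw [h3, _root_.inner_zero_right] at h4
  have h5 : ρ a (Finsupp.single (f, PUnit.unit) (star a)) =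
      Finsupp.single (f, PUnit.unit) (a * star a) :=
    Finsupp.mapRange_single (hf := mul_zero a)
  rw [h5] at h4
  refine hf ?_
  have h6 := Finsupp.sum_single_index (a := ((f, PUnit.unit) : (A →ₚ[ℂ] ℂ) × PUnit.{v + 1}))
    (b := a * star a) (h := fun p b => p.1 (star b *
      (Finsupp.single ((f, PUnit.unit) : (A →ₚ[ℂ] ℂ) × PUnit.{v + 1}) (a * star a) p)))
    (by simp)
  rw [Finsupp.single_eq_same] at h6
  exact h6.symm.trans h4.symm

end Faithful

/-! ### Positive quadratic forms over a C⋆-algebra -/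

section Gram

variable {A : Type u} [NonUnitalCStarAlgebra A] [PartialOrder A] [StarOrderedRing A]

/-- The properties of the negative part of a self-adjoint element that do not mention the order. -/
lemma exists_negPart {C : Type*} [NonUnitalCStarAlgebra C] (g : C) (hg : star g = g) :
    ∃ N : C, star N = N ∧ N * g * N = -(N * N * N) ∧ (∃ M, N * N * N = star M * M) ∧
      (N = 0 → ∃ S, g = star S * S) := by
  -- The order stays inside this proof: the conclusion is algebraic and applies to matrix algebras
  -- on which no order has been chosen.
  letI : PartialOrder C := CStarAlgebra.spectralOrder C
  haveI : StarOrderedRing C := CStarAlgebra.spectralOrderedRing C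
  have hsa : IsSelfAdjoint g := hg
  have hN : 0 ≤ g⁻ := CFC.negPart_nonneg g
  have hNs : star g⁻ = g⁻ := (IsSelfAdjoint.of_nonneg hN).star_eq
  refine ⟨g⁻, hNs, ?_, ?_, fun h => ?_⟩
  · have h := congrArg (g⁻ * ·) (CFC.posPart_sub_negPart g hsa)
    simp only [mul_sub, CFC.negPart_mul_posPart, zero_sub] at h
    rw [← h, neg_mul]
  · have := star_left_conjugate_nonneg hN g⁻
    rw [hNs] at this
    exact CStarAlgebra.nonneg_iff_eq_star_mul_self.mp this
  · exact CStarAlgebra.nonneg_iff_eq_star_mul_self.mp ((CFC.negPart_eq_zero_iff g hsa).mp h)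

/-- A matrix over a C⋆-algebra whose quadratic form is positive is a square. -/
theorem exists_eq_star_mul_self_of_form_nonneg {n : Type*} [Fintype n] (G : CStarMatrix n n A)
    (hG : star G = G) (h : ∀ v : n → A, 0 ≤ ∑ i, ∑ j, star (v i) * G i j * v j) :
    ∃ S : CStarMatrix n n A, G = star S * S := by
  obtain ⟨N, hNs, h1, ⟨M, hM⟩, hS⟩ := exists_negPart G hG
  -- The form evaluated at column i of N is the (i,i) entry of NGN, hence positive. Since NGN =
  -- -M*M, that entry is also negative, so column i of M vanishes.
  have hd : ∀ i, ∑ k, star (M k i) * M k i = 0 := by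
    intro i
    have e1 : (N * N * N) i i = ∑ k, star (M k i) * M k i := by
      rw [hM, CStarMatrix.mul_apply]
      rfl
    refine eq_zero_of_nonneg_of_neg_nonneg (Finset.sum_nonneg fun k _ => star_mul_self_nonneg _) ?_
    rw [← e1]
    have e2 := congrFun (congrFun h1 i) i
    have e3 : (-(N * N * N)) i i = -((N * N * N) i i) := rfl
    rw [← e3, ← h1]
    have e4 : (N * G * N) i i = ∑ k, ∑ j, star (N k i) * G k j * N j i := by
      rw [CStarMatrix.mul_apply, Finset.sum_comm]
      refine Finset.sum_congr rfl fun j _ => ?_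
      rw [CStarMatrix.mul_apply, Finset.sum_mul]
      refine Finset.sum_congr rfl fun k _ => ?_
      have : N i k = star (N k i) := by
        conv_lhs => rw [← hNs]
        rfl
      rw [this]
    rw [e4]
    exact h fun k => N k i
  have hM0 : M = 0 := by
    ext k i
    have := (Finset.sum_eq_zero_iff_of_nonneg
      (fun k _ => star_mul_self_nonneg (M k i))).mp (hd i) k (Finset.mem_univ k)
    exact (CStarRing.star_mul_self_eq_zero_iff _).mp this
  have hN3 : N * N * N = 0 := by rw [hM, hM0, mul_zero]
  -- N⁴ = 0 for self-adjoint N, and the C⋆-identity applied twice gives N = 0; thus G has no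
  -- negative part.
  have hN4 : star (star N * N) * (star N * N) = 0 := by
    rw [star_mul, star_star, hNs, ← mul_assoc, hN3, zero_mul]
  rw [CStarRing.star_mul_self_eq_zero_iff, CStarRing.star_mul_self_eq_zero_iff] at hN4
  exact hS hN4

variable {H : Type*} [NormedAddCommGroup H] [InnerProductSpace ℂ H] [CompleteSpace H]

/-- Matrices over a C⋆-algebra with a positive quadratic form act positively in representations. -/
theorem re_sum_inner_nonneg {n : Type*} [Fintype n] (π : A →⋆ₙₐ[ℂ] (H →L[ℂ] H)) (G : n → n → A)
    (hG : ∀ i j, star (G i j) = G j i)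
    (h : ∀ v : n → A, 0 ≤ ∑ i, ∑ j, star (v i) * G i j * v j) (x : n → H) :
    0 ≤ (∑ i, ∑ j, inner ℂ (x i) (π (G i j) (x j))).re := by
  obtain ⟨S, hS⟩ := exists_eq_star_mul_self_of_form_nonneg (CStarMatrix.ofMatrix G)
    (by ext i j; exact hG j i) h
  have hGS : ∀ i j, G i j = ∑ k, star (S k i) * S k j := fun i j => by
    have : (CStarMatrix.ofMatrix G) i j = (star S * S) i j := by rw [hS]
    rw [CStarMatrix.mul_apply] at this
    exact this
  -- With G = S*S the double sum becomes a sum of squared norms.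
  have : ∑ i, ∑ j, inner ℂ (x i) (π (G i j) (x j)) =
      ∑ k, inner ℂ (∑ i, π (S k i) (x i)) (∑ j, π (S k j) (x j)) := by
    simp only [sum_inner, inner_sum, hGS, map_sum, _root_.sum_apply, map_mul, map_star,
      mul_apply_eq_comp, ContinuousLinearMap.star_eq_adjoint,
      ContinuousLinearMap.adjoint_inner_right]
    rw [Finset.sum_comm_cycle]
    exact Finset.sum_congr rfl fun k _ => Finset.sum_comm
  rw [this, Complex.re_sum]
  exact Finset.sum_nonneg fun k _ => inner_self_nonneg (𝕜 := ℂ)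

end Gram

/-! ### Interior tensor products with a Hilbert space -/

section Tensor

variable {A : Type u} [NonUnitalCStarAlgebra A] [PartialOrder A] [StarOrderedRing A]
  {Y : Type v} [AddCommGroup Y] [Module ℂ Y]

/-- Positive semidefinite sesquilinear maps with values in a C⋆-algebra. -/
structure IsGram (G : Y → Y → A) : Prop where
  add_right (x y z : Y) : G x (y + z) = G x y + G x z
  smul_right (c : ℂ) (x y : Y) : G x (c • y) = c • G x y
  star_apply (x y : Y) : star (G x y) = G y x
  nonneg (s : Finset Y) (a : Y → A) : 0 ≤ ∑ x ∈ s, ∑ y ∈ s, star (a x) * G x y * a y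

variable {H : Type w} [NormedAddCommGroup H] [InnerProductSpace ℂ H] [CompleteSpace H]

/-- The tensor product over `A` of a semi-inner product `A`-module with a Hilbert space on which `A`
is represented. -/
theorem exists_tensor {G : Y → Y → A} (hG : IsGram G) (π : A →⋆ₙₐ[ℂ] (H →L[ℂ] H)) :
    ∃ (K : Type (max v w)) (_ : NormedAddCommGroup K) (_ : InnerProductSpace ℂ K)
      (_ : CompleteSpace K) (ι : (Y →₀ H) →ₗ[ℂ] K), DenseRange ι ∧
      ∀ x y h k, inner ℂ (ι (Finsupp.single x h)) (ι (Finsupp.single y k)) =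
        inner ℂ h (π (G x y) k) := by
  -- No relations are imposed on formal sums, not even additivity in y: the differences are null
  -- vectors, which the completion kills.
  let B : (Y →₀ H) → (Y →₀ H) → ℂ := fun p q =>
    p.sum fun x h => q.sum fun y k => inner ℂ h (π (G x y) k)
  have hBs : ∀ p q : Y →₀ H, ∀ s, p.support ⊆ s → ∀ t, q.support ⊆ t →
      B p q = ∑ x ∈ s, ∑ y ∈ t, inner ℂ (p x) (π (G x y) (q y)) := fun p q s hs t ht => by
    rw [← Finsupp.sum_of_support_subset p hs
      (fun x h => ∑ y ∈ t, inner ℂ h (π (G x y) (q y))) (by simp)]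
    exact Finsupp.sum_congr fun x _ => Finsupp.sum_of_support_subset q ht _ (by simp)
  let c : PreInnerProductSpace.Core ℂ (Y →₀ H) :=
    { inner := B
      conj_inner_symm := fun p q => by
        rw [hBs p q _ subset_rfl _ subset_rfl, hBs q p _ subset_rfl _ subset_rfl, map_sum,
          Finset.sum_comm]
        simp only [map_sum]
        refine Finset.sum_congr rfl fun x _ => Finset.sum_congr rfl fun y _ => ?_
        rw [inner_conj_symm, ← hG.star_apply, map_star, ContinuousLinearMap.star_eq_adjoint,
          ContinuousLinearMap.adjoint_inner_left]
      re_inner_nonneg := fun p => by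
        rw [hBs p p _ subset_rfl _ subset_rfl]
        have := re_sum_inner_nonneg (n := p.support) π (fun x y => G x y)
          (fun x y => hG.star_apply x y) (fun a => by
            classical
            have h := hG.nonneg p.support fun x => if hx : x ∈ p.support then a ⟨x, hx⟩ else 0
            rw [← Finset.sum_coe_sort] at h
            simp_rw [← Finset.sum_coe_sort p.support] at h
            simpa using h) (fun x => p x)
        rw [← Finset.sum_coe_sort]
        simp_rw [← Finset.sum_coe_sort p.support]
        exact this
      add_left := fun p q r => by
        refine Finsupp.sum_add_index' (by simp) fun x h k => ?_
        rw [← Finsupp.sum_add]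
        exact Finsupp.sum_congr fun y _ => _root_.inner_add_left _ _ _
      smul_left := fun p q z => by
        change B (z • p) q = _ * B p q
        rw [hBs (z • p) q p.support Finsupp.support_smul _ subset_rfl,
          hBs p q _ subset_rfl _ subset_rfl, Finset.mul_sum]
        refine Finset.sum_congr rfl fun x _ => ?_
        rw [Finset.mul_sum]
        exact Finset.sum_congr rfl fun y _ => _root_.inner_smul_left _ _ _ }
  obtain ⟨K, i1, i2, i3, ι, hι, hin⟩ := exists_completion c
  refine ⟨K, i1, i2, i3, ι, hι, fun x y h k => ?_⟩
  rw [hin]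
  change B _ _ = _
  simp [B]

variable {K : Type*} [NormedAddCommGroup K] [InnerProductSpace ℂ K]
  {ι : (Y →₀ H) →ₗ[ℂ] K}

lemma eq_of_inner_single (hι : DenseRange ι) {z z' : K}
    (h : ∀ y k, inner ℂ (ι (Finsupp.single y k)) z = inner ℂ (ι (Finsupp.single y k)) z') :
    z = z' :=
  eq_of_inner_dense hι fun p => by
    induction p using Finsupp.induction_linear with
    | zero => rw [map_zero, _root_.inner_zero_left, _root_.inner_zero_left]
    | add p q hp hq => rw [map_add, _root_.inner_add_left, _root_.inner_add_left, hp, hq]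
    | single y k => exact h y k

/-- The creation operators `h ↦ y ⊗ h`. -/
theorem exists_creation {G : Y → Y → A} (hG : IsGram G) (π : A →⋆ₙₐ[ℂ] (H →L[ℂ] H))
    (hι : DenseRange ι)
    (hin : ∀ x y h k, inner ℂ (ι (Finsupp.single x h)) (ι (Finsupp.single y k)) =
        inner ℂ h (π (G x y) k)) :
    ∃ T : Y →ₗ[ℂ] (H →L[ℂ] K), ∀ y h, T y h = ι (Finsupp.single y h) := by
  have hb : ∀ y h, ‖ι (Finsupp.single y h)‖ ≤ √‖π (G y y)‖ * ‖h‖ := fun y h => by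
    refine le_of_sq_le_sq ?_ (by positivity)
    rw [mul_pow, Real.sq_sqrt (norm_nonneg _), ← inner_self_eq_norm_sq (𝕜 := ℂ), hin]
    calc _ ≤ ‖h‖ * ‖π (G y y) h‖ := re_inner_le_norm _ _
      _ ≤ ‖h‖ * (‖π (G y y)‖ * ‖h‖) := by gcongr; exact ContinuousLinearMap.le_opNorm _ _
      _ = _ := by ring
  refine ⟨{ toFun := fun y => (ι.comp (Finsupp.lsingle y)).mkContinuous _ (hb y),
            map_add' := fun x y => ?_, map_smul' := fun c x => ?_ }, fun y h => rfl⟩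
  -- Both sides have the same inner products with simple tensors, because the Gram map is additive.
  · refine ContinuousLinearMap.ext fun h => eq_of_inner_single hι fun z k => ?_
    change inner ℂ _ (ι (Finsupp.single (x + y) h)) =
      inner ℂ _ (ι (Finsupp.single x h) + ι (Finsupp.single y h))
    rw [_root_.inner_add_right, hin, hin, hin, hG.add_right, map_add, _root_.add_apply,
      _root_.inner_add_right]
  · refine ContinuousLinearMap.ext fun h => eq_of_inner_single hι fun z k => ?_
    change inner ℂ _ (ι (Finsupp.single (c • x) h)) = inner ℂ _ (c • ι (Finsupp.single x h))
    rw [_root_.inner_smul_right, hin, hin, hG.smul_right, map_smul, _root_.smul_apply,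
      _root_.inner_smul_right]

/-- Actions by adjointable maps on the first factor of a tensor product. -/
theorem exists_induced [CompleteSpace K] {G : Y → Y → A} (π : A →⋆ₙₐ[ℂ] (H →L[ℂ] H))
    (hι : DenseRange ι)
    (hin : ∀ x y h k, inner ℂ (ι (Finsupp.single x h)) (ι (Finsupp.single y k)) =
        inner ℂ h (π (G x y) k))
    (T : Y →ₗ[ℂ] (H →L[ℂ] K)) (hT : ∀ y h, T y h = ι (Finsupp.single y h))
    {E : Type*} [NonUnitalCStarAlgebra E] (σ : E → Y → Y)
    (hstar : ∀ e x y, G (σ e x) y = G x (σ (star e) y))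
    (hadd : ∀ e f y, σ (e + f) y = σ e y + σ f y) (hsmul : ∀ (c : ℂ) e y, σ (c • e) y = c • σ e y)
    (hmul : ∀ e f y, σ (e * f) y = σ e (σ f y)) :
    ∃ P : E →⋆ₙₐ[ℂ] (K →L[ℂ] K), ∀ e y h, P e (T y h) = T (σ e y) h := by
  let ρ : E → (Y →₀ H) →ₗ[ℂ] (Y →₀ H) := fun e => Finsupp.lmapDomain H ℂ (σ e)
  have hρ : ∀ e y h, ι (ρ e (Finsupp.single y h)) = T (σ e y) h := fun e y h => by
    rw [hT]
    exact congrArg ι Finsupp.mapDomain_single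
  obtain ⟨P, hP⟩ := exists_starHom hι ρ
    (fun e p q => by
      induction p using Finsupp.induction_linear with
      | zero => simp
      | add p p' hp hp' => simp only [map_add, _root_.inner_add_left, hp, hp']
      | single x h =>
        induction q using Finsupp.induction_linear with
        | zero => simp
        | add q q' hq hq' => simp only [map_add, _root_.inner_add_right, hq, hq']
        | single y k => rw [hρ, hρ, hT, hT, hin, hin, hstar])
    -- On formal sums the pushforward along `σ e` is not additive in e; it becomes so after `ι`,
    -- through the additivity of `T`.
    (fun e f p => by
      induction p using Finsupp.induction_linear with
      | zero => simp
      | add p q hp hq => simp only [map_add, hp, hq]; abel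
      | single y h => rw [hρ, hρ, hρ, hadd, map_add, _root_.add_apply])
    (fun c e p => by
      induction p using Finsupp.induction_linear with
      | zero => simp
      | add p q hp hq => simp only [map_add, hp, hq, smul_add]
      | single y h => rw [hρ, hρ, hsmul, map_smul, _root_.smul_apply])
    (fun e f p => by
      induction p using Finsupp.induction_linear with
      | zero => simp
      | add p q hp hq => simp only [map_add, hp, hq]
      | single y h =>
        have : ρ f (Finsupp.single y h) = Finsupp.single (σ f y) h := Finsupp.mapDomain_single
        rw [this, hρ, hρ, hmul])
  exact ⟨P, fun e y h => by rw [hT, hP, hρ]⟩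

end Tensor

/-! ### One step: from a representation on H to one on (X ⊕ ker φ) ⊗ H -/

section Step

variable {A : Type u} {X : Type v} [NonUnitalCStarAlgebra A] [PartialOrder A] [StarOrderedRing A]
  [NormedAddCommGroup X] [NormedSpace ℂ X] [CompleteSpace X] [SMul Aᵐᵒᵖ X] [HilbertModule A X]

open HilbertModule

variable (A) in
lemma inner_sum_right {α : Type*} (s : Finset α) (ξ : X) (f : α → X) :
    inner A ξ (∑ i ∈ s, f i) = ∑ i ∈ s, inner A ξ (f i) :=
  map_sum (AddMonoidHom.mk' (fun η : X => inner A ξ η) (inner_add ξ)) f s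

variable (A) in
lemma inner_sum_left {α : Type*} (s : Finset α) (ξ : X) (f : α → X) :
    inner A (∑ i ∈ s, f i) ξ = ∑ i ∈ s, inner A (f i) ξ := by
  rw [← inner_star, inner_sum_right, star_sum]
  exact Finset.sum_congr rfl fun i _ => inner_star _ _

/-- The kernel of the left action. -/
def leftKer (φ : A →⋆ₙₐ[ℂ] Adj A X) : Submodule ℂ A := LinearMap.ker (φ : A →ₗ[ℂ] Adj A X)

variable {φ : A →⋆ₙₐ[ℂ] Adj A X}

lemma mem_leftKer {a : A} : a ∈ leftKer φ ↔ φ a = 0 := Iff.rfl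

lemma mul_mem_leftKer (a : A) {b : A} (hb : b ∈ leftKer φ) : a * b ∈ leftKer φ := by
  rw [mem_leftKer] at *
  rw [map_mul, hb, mul_zero]

/-- The `A`-valued inner product on the direct sum of `X` and the kernel of the left action. -/
def gram (φ : A →⋆ₙₐ[ℂ] Adj A X) (x y : X × leftKer φ) : A :=
  inner A x.1 y.1 + star (x.2 : A) * y.2

lemma isGram_gram : IsGram (gram φ) where
  add_right x y z := by
    simp only [gram, Prod.fst_add, Prod.snd_add, inner_add, Submodule.coe_add, mul_add]
    abel
  smul_right c x y := by
    simp only [gram, Prod.smul_fst, Prod.smul_snd, inner_smul, Submodule.coe_smul, mul_smul_comm,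
      smul_add]
  star_apply x y := by simp only [gram, star_add, inner_star, star_mul, star_star]
  nonneg s a := by
    -- The form is ⟨ζ,ζ⟩ + c*c, where (ζ, c) is the combination of the vectors with coefficients `a`
    -- on the right.
    have : ∑ x ∈ s, ∑ y ∈ s, star (a x) * gram φ x y * a y =
        inner A (∑ x ∈ s, x.1 <• a x) (∑ x ∈ s, x.1 <• a x) +
          star (∑ x ∈ s, (x.2 : A) * a x) * ∑ x ∈ s, (x.2 : A) * a x := by
      simp only [gram, inner_sum_right, inner_sum_left, star_sum, Finset.sum_mul, Finset.mul_sum,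
        inner_act, inner_act_left, star_mul, mul_add, add_mul, Finset.sum_add_distrib, mul_assoc]
      congr 1
      · exact Finset.sum_comm
      · exact Finset.sum_comm
    rw [this]
    exact add_nonneg (inner_nonneg _) (star_mul_self_nonneg _)

/-- The kernel is self-adjoint, so b = a* is allowed and aa* = 0. This is why adding the summand ker
φ to `X` restores faithfulness when `φ` is not injective. -/
lemma eq_zero_of_leftKer_of_perp {a : A} (h : φ a = 0) (h' : ∀ b ∈ leftKer φ, a * b = 0) :
    a = 0 := by
  have : star a ∈ leftKer φ := by rw [mem_leftKer, map_star, h, star_zero]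
  exact (CStarRing.mul_star_self_eq_zero_iff a).mp (h' _ this)

variable (φ) in
/-- Data which relate a representation of `A` on `H` to one on a space that contains
`X ⊗ H`. -/
structure Step {H K : Type*} [NormedAddCommGroup H] [InnerProductSpace ℂ H] [CompleteSpace H]
    [NormedAddCommGroup K] [InnerProductSpace ℂ K] [CompleteSpace K]
    (π : A →⋆ₙₐ[ℂ] (H →L[ℂ] H)) (π' : A →⋆ₙₐ[ℂ] (K →L[ℂ] K)) where
  T : X →ₗ[ℂ] (H →L[ℂ] K)
  L : Adj A X →⋆ₙₐ[ℂ] (K →L[ℂ] K)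
  inner_T (ξ η : X) (h k : H) : inner ℂ (T ξ h) (T η k) = inner ℂ h (π (inner A ξ η) k)
  left_T (a : A) (ξ : X) (h : H) : π' a (T ξ h) = T ((φ a).op ξ) h
  L_theta (ξ η : X) (z : K) : L (theta A ξ η) z = T ξ (ContinuousLinearMap.adjoint (T η) z)
  left_eq (a : A) (ha : a ∈ idealJ φ) : π' a = L (φ a)

-- The summand `X` carries the creation operators and the action of 𝓛(X); the summand ker φ is there
-- only to keep the new representation of `A` faithful. It does not disturb covariance, since `J_X`
-- annihilates it.
variable (φ) in
theorem exists_step {H : Type (max u v)} [NormedAddCommGroup H] [InnerProductSpace ℂ H]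
    [CompleteSpace H] (π : A →⋆ₙₐ[ℂ] (H →L[ℂ] H)) (hπ : Function.Injective π) :
    ∃ (K : Type (max u v)) (_ : NormedAddCommGroup K) (_ : InnerProductSpace ℂ K)
      (_ : CompleteSpace K) (π' : A →⋆ₙₐ[ℂ] (K →L[ℂ] K)), Function.Injective π' ∧
      Nonempty (Step φ π π') := by
  obtain ⟨K, i1, i2, i3, ι, hι, hin⟩ := exists_tensor (isGram_gram (φ := φ)) π
  obtain ⟨T, hT⟩ := exists_creation isGram_gram π hι hin
  have hinT : ∀ x y h k, inner ℂ (T x h) (T y k) = inner ℂ h (π (gram φ x y) k) := by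
    intro x y h k
    rw [hT, hT, hin]
  have hext : ∀ {z z' : K}, (∀ y k, inner ℂ (T y k) z = inner ℂ (T y k) z') → z = z' :=
    fun h => eq_of_inner_single hι fun y k => by rw [← hT, h]
  -- Simple tensors are total in K; passing to adjoints reduces the equality of operators to inner
  -- products with them.
  have hclm : ∀ {S S' : K →L[ℂ] K}, (∀ y k, S (T y k) = S' (T y k)) → S = S' := fun h =>
    ContinuousLinearMap.adjoint.injective <| ContinuousLinearMap.ext fun z => hext fun y k => by
      rw [ContinuousLinearMap.adjoint_inner_right, ContinuousLinearMap.adjoint_inner_right, h]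
  obtain ⟨π', hπ'⟩ := exists_induced π hι hin T hT
    (fun (a : A) (y : X × leftKer φ) =>
      (((φ a).op y.1, ⟨a * y.2, mul_mem_leftKer a y.2.2⟩) : X × leftKer φ))
    (fun a x y => by
      simp only [gram, inner_left, map_star, star_mul, mul_assoc])
    (fun a b y => Prod.ext (by rw [map_add]; rfl) (Subtype.ext (add_mul _ _ _)))
    (fun c a y => Prod.ext (by rw [map_smul]; rfl) (Subtype.ext (smul_mul_assoc _ _ _)))
    (fun a b y => Prod.ext (by rw [map_mul]; rfl) (Subtype.ext (mul_assoc _ _ _)))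
  -- An operator S on `X` acts as S ⊕ 0 on X ⊕ ker φ.
  obtain ⟨L, hL⟩ := exists_induced π hι hin T hT
    (fun (S : Adj A X) (y : X × leftKer φ) => ((S.op y.1, 0) : X × leftKer φ))
    (fun S x y => by
      simp only [gram, inner_left, ZeroMemClass.coe_zero, star_zero, zero_mul, mul_zero])
    (fun S S' y => Prod.ext rfl (add_zero _).symm)
    (fun c S y => Prod.ext rfl (smul_zero _).symm)
    (fun S S' y => Prod.ext rfl rfl)
  refine ⟨K, i1, i2, i3, π', (injective_iff_map_eq_zero π').mpr fun a ha => ?_, ⟨?_⟩⟩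
  · have h1 : ∀ y : X × leftKer φ,
        (φ a).op y.1 = 0 ∧ a * y.2 = 0 := by
      intro y
      -- If a acts as 0, then π(⟨ay, ay⟩) = 0. Injectivity of π makes ⟨ay, ay⟩ vanish, and with it
      -- both of its positive summands.
      have h2 : π (gram φ ((φ a).op y.1, ⟨a * y.2, mul_mem_leftKer a y.2.2⟩)
          ((φ a).op y.1, ⟨a * y.2, mul_mem_leftKer a y.2.2⟩)) = 0 :=
        ContinuousLinearMap.ext fun k => ext_inner_left ℂ fun h => by
          rw [← hinT, ← hπ' a y k, ha, _root_.zero_apply, _root_.zero_apply,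
            _root_.inner_zero_right, _root_.inner_zero_right]
      have h3 := (injective_iff_map_eq_zero π).mp hπ _ h2
      have h4 := (add_eq_zero_iff_of_nonneg (inner_nonneg (A := A) ((φ a).op y.1))
        (star_mul_self_nonneg (a * (y.2 : A)))).mp h3
      exact ⟨eq_zero_of_inner_self A h4.1, (CStarRing.star_mul_self_eq_zero_iff _).mp h4.2⟩
    exact eq_zero_of_leftKer_of_perp (φ := φ)
      (Adj.op_injective <| ContinuousLinearMap.ext fun ξ => (h1 (ξ, 0)).1)
      fun b hb => (h1 (0, ⟨b, hb⟩)).2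
  · exact
      { T := T.comp (LinearMap.inl ℂ X (leftKer φ))
        L := L
        inner_T := fun ξ η h k => by
          refine (hinT _ _ h k).trans ?_
          simp [gram]
        left_T := fun a ξ h => by
          refine (hπ' a (ξ, 0) h).trans ?_
          have : (⟨a * ((0 : leftKer φ) : A), mul_mem_leftKer a (0 : leftKer φ).2⟩ : leftKer φ) = 0 :=
            Subtype.ext (mul_zero a)
          rw [this]
          rfl
        L_theta := fun ξ η z => by
          suffices h : L (theta A ξ η) =
              (T (ξ, 0)).comp (ContinuousLinearMap.adjoint (T (η, 0))) by rw [h]; rfl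
          refine hclm fun y k => hext fun x h => ?_
          have h1 : ContinuousLinearMap.adjoint (T (η, 0)) (T y k) = π (inner A η y.1) k :=
            ext_inner_left ℂ fun h => by
              rw [ContinuousLinearMap.adjoint_inner_right, hinT]
              simp [gram]
          rw [hL, ContinuousLinearMap.comp_apply, h1, hinT, hinT, ← mul_apply_eq_comp, ← map_mul,
            theta_apply]
          simp only [gram, inner_act, ZeroMemClass.coe_zero, mul_zero, add_zero]
        left_eq := fun a ha => hclm fun y k => by
          rw [hL, hπ']
          -- As a ∈ (ker φ)^⊥, the second coordinate of ay is 0, exactly as for φ(a) ⊕ 0.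
          have : (⟨a * (y.2 : A), mul_mem_leftKer a y.2.2⟩ : leftKer φ) = 0 :=
            Subtype.ext (ha.2 _ y.2.2)
          rw [this] }

end Step

/-! ### Banach limits as ultralimits of Cesàro means -/

section BanachLimit

open Filter Topology

lemma norm_sum_range_le {x : ℕ → ℂ} {C : ℝ} (hx : ∀ n, ‖x n‖ ≤ C) (n : ℕ) :
    ‖((n : ℂ) + 1)⁻¹ * ∑ k ∈ Finset.range (n + 1), x k‖ ≤ C := by
  have h1 : ‖((n : ℂ) + 1)‖ = (n : ℝ) + 1 := by
    rw [← Nat.cast_succ, Complex.norm_natCast, Nat.cast_succ]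
  rw [norm_mul, norm_inv, h1, inv_mul_le_iff₀ (by positivity)]
  refine (norm_sum_le_of_le _ fun k _ => hx k).trans ?_
  simp

/-- There is a Banach limit on the bounded sequences. -/
theorem exists_banachLimit : ∃ Λ : (ℕ → ℂ) → ℂ,
    (∀ x y : ℕ → ℂ, (∃ C, ∀ n, ‖x n‖ ≤ C) → (∃ C, ∀ n, ‖y n‖ ≤ C) →
      Λ (fun n => x n + y n) = Λ x + Λ y) ∧
    (∀ (c : ℂ) (x : ℕ → ℂ), (∃ C, ∀ n, ‖x n‖ ≤ C) → Λ (fun n => c * x n) = c * Λ x) ∧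
    (∀ x : ℕ → ℂ, (∃ C, ∀ n, ‖x n‖ ≤ C) → Λ (fun n => star (x n)) = star (Λ x)) ∧
    (∀ (r : ℝ) (x : ℕ → ℂ), (∃ C, ∀ n, ‖x n‖ ≤ C) → (∀ n, r ≤ (x n).re) → r ≤ (Λ x).re) ∧
    (∀ x : ℕ → ℂ, (∃ C, ∀ n, ‖x n‖ ≤ C) → Λ (fun n => x (n + 1)) = Λ x) := by
  let U : Ultrafilter ℕ := hyperfilter ℕ
  have hU : (U : Filter ℕ) ≤ atTop := Nat.hyperfilter_le_atTop
  let m : (ℕ → ℂ) → ℕ → ℂ := fun x n => ((n : ℂ) + 1)⁻¹ * ∑ k ∈ Finset.range (n + 1), x k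
  have hm : ∀ x : ℕ → ℂ, (∃ C, ∀ n, ‖x n‖ ≤ C) →
      Tendsto (m x) U (𝓝 (limUnder (U : Filter ℕ) (m x))) := by
    rintro x ⟨C, hC⟩
    -- The means stay in a compact disc, so they converge along the ultrafilter.
    obtain ⟨z, -, hz⟩ := (isCompact_closedBall (0 : ℂ) C).ultrafilter_le_nhds (U.map (m x))
      (by
        rw [Ultrafilter.coe_map, le_principal_iff, mem_map]
        exact univ_mem' fun n => mem_closedBall_zero_iff.mpr (norm_sum_range_le hC n))
    exact tendsto_nhds_limUnder ⟨z, hz⟩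
  refine ⟨fun x => limUnder (U : Filter ℕ) (m x), ?_, ?_, ?_, ?_, ?_⟩
  · intro x y hx hy
    refine Tendsto.limUnder_eq (((hm x hx).add (hm y hy)).congr fun n => ?_)
    simp only [m, Finset.sum_add_distrib, mul_add]
  · intro c x hx
    refine Tendsto.limUnder_eq (((hm x hx).const_mul c).congr fun n => ?_)
    simp only [m, ← Finset.mul_sum]
    ring
  · intro x hx
    refine Tendsto.limUnder_eq ((hm x hx).star.congr fun n => ?_)
    simp [m]
  · intro r x hx hr
    refine ge_of_tendsto' ((Complex.continuous_re.tendsto _).comp (hm x hx)) fun n => ?_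
    have h1 : ((n : ℂ) + 1)⁻¹ = (((n : ℝ) + 1)⁻¹ : ℝ) := by push_cast; rfl
    simp only [Function.comp, m]
    rw [h1, Complex.re_ofReal_mul, Complex.re_sum, le_inv_mul_iff₀ (by positivity)]
    refine le_trans ?_ (Finset.sum_le_sum fun k _ => hr k)
    simp
  · intro x hx
    obtain ⟨C, hC⟩ := hx
    -- The means of the shifted and the original sequence differ by (x(n+1) - x(0))/(n+1), which
    -- tends to 0; the ultrafilter must be free for this to suffice.
    have h0 : Tendsto (fun n : ℕ => ((n : ℂ) + 1)⁻¹ * (x (n + 1) - x 0)) U (𝓝 0) := by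
      refine Tendsto.mono_left ?_ hU
      have h1 : Tendsto (fun n : ℕ => (1 / ((n : ℝ) + 1)) * (C + C)) atTop (𝓝 0) := by
        simpa using tendsto_one_div_add_atTop_nhds_zero_nat.mul_const (C + C)
      refine squeeze_zero_norm (fun n => ?_) h1
      have h2 : ‖((n : ℂ) + 1)‖ = (n : ℝ) + 1 := by
        rw [← Nat.cast_succ, Complex.norm_natCast, Nat.cast_succ]
      rw [norm_mul, norm_inv, h2, one_div]
      gcongr
      exact (norm_sub_le _ _).trans (add_le_add (hC _) (hC _))
    have h3 := (hm x ⟨C, hC⟩).add h0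
    rw [add_zero] at h3
    refine Tendsto.limUnder_eq (h3.congr fun n => ?_)
    simp only [m]
    rw [← mul_add]
    congr 1
    have h4 := Finset.sum_range_succ x (n + 1)
    rw [Finset.sum_range_succ'] at h4
    linear_combination -h4

end BanachLimit

/-! ### The limit representation on bounded sequences -/

section Limit

variable {A : Type u} {X : Type v} [NonUnitalCStarAlgebra A] [PartialOrder A] [StarOrderedRing A]
  [NormedAddCommGroup X] [NormedSpace ℂ X] [CompleteSpace X] [SMul Aᵐᵒᵖ X] [HilbertModule A X]
  {φ : A →⋆ₙₐ[ℂ] Adj A X}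

/-- The bound is the same at every step, so the creation operators for a fixed ξ act together on
bounded sequences. -/
lemma Step.norm_T_le {H K : Type*} [NormedAddCommGroup H] [InnerProductSpace ℂ H] [CompleteSpace H]
    [NormedAddCommGroup K] [InnerProductSpace ℂ K] [CompleteSpace K]
    {π : A →⋆ₙₐ[ℂ] (H →L[ℂ] H)} {π' : A →⋆ₙₐ[ℂ] (K →L[ℂ] K)} (S : Step φ π π') (ξ : X) :
    ‖S.T ξ‖ ≤ ‖ξ‖ := by
  refine ContinuousLinearMap.opNorm_le_bound _ (norm_nonneg _) fun h => ?_
  refine le_of_sq_le_sq ?_ (by positivity)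
  rw [← inner_self_eq_norm_sq (𝕜 := ℂ), S.inner_T]
  calc _ ≤ ‖h‖ * ‖π (inner A ξ ξ) h‖ := re_inner_le_norm _ _
    _ ≤ ‖h‖ * (‖ξ‖ ^ 2 * ‖h‖) := by
      gcongr
      refine (ContinuousLinearMap.le_opNorm _ _).trans ?_
      gcongr
      rw [norm_sq (A := A)]
      exact NonUnitalStarAlgHom.norm_apply_le π _
    _ = _ := by ring

variable {H : ℕ → Type w} [∀ n, NormedAddCommGroup (H n)] [∀ n, InnerProductSpace ℂ (H n)]

variable (H) in
/-- The bounded sequences with terms in the given Hilbert spaces. -/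
def boundedSeq : Submodule ℂ (∀ n, H n) where
  carrier := {h | ∃ C, ∀ n, ‖h n‖ ≤ C}
  add_mem' := by
    rintro g h ⟨C, hC⟩ ⟨D, hD⟩
    exact ⟨C + D, fun n => (norm_add_le _ _).trans (add_le_add (hC n) (hD n))⟩
  zero_mem' := ⟨0, fun n => norm_zero.le⟩
  smul_mem' := by
    rintro c h ⟨C, hC⟩
    exact ⟨‖c‖ * C, fun n => (norm_smul c (h n)).trans_le (by gcongr; exact hC n)⟩

lemma bounded_inner (g h : boundedSeq H) : ∃ C, ∀ n, ‖inner ℂ (g.1 n) (h.1 n)‖ ≤ C := by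
  obtain ⟨C, hC⟩ := g.2
  obtain ⟨D, hD⟩ := h.2
  exact ⟨C * D, fun n => (_root_.norm_inner_le_norm _ _).trans
    (mul_le_mul (hC n) (hD n) (norm_nonneg _) ((norm_nonneg _).trans (hC n)))⟩

/-- Uniformly bounded operators on the terms of a sequence. -/
def diagMap (D : ∀ n, H n →L[ℂ] H n) (hD : ∃ C, ∀ n, ‖D n‖ ≤ C) :
    boundedSeq H →ₗ[ℂ] boundedSeq H where
  toFun h := ⟨fun n => D n (h.1 n), by
    obtain ⟨C, hC⟩ := hD
    obtain ⟨C', hC'⟩ := h.2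
    exact ⟨C * C', fun n => (D n).le_of_opNorm_le_of_le (hC n) (hC' n)⟩⟩
  map_add' g h := Subtype.ext (funext fun n => map_add (D n) _ _)
  map_smul' c h := Subtype.ext (funext fun n => map_smul (D n) c _)

/-- Uniformly bounded operators which raise the index by one. -/
def shiftUp (T : ∀ n, H n →L[ℂ] H (n + 1)) (hT : ∃ C, ∀ n, ‖T n‖ ≤ C) :
    boundedSeq H →ₗ[ℂ] boundedSeq H where
  toFun h := ⟨fun
    | 0 => 0
    | n + 1 => T n (h.1 n), by
    obtain ⟨C, hC⟩ := hT
    obtain ⟨C', hC'⟩ := h.2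
    refine ⟨C * C', fun
      | 0 => ?_
      | n + 1 => (T n).le_of_opNorm_le_of_le (hC n) (hC' n)⟩
    rw [norm_zero]
    exact mul_nonneg ((norm_nonneg _).trans (hC 0)) ((norm_nonneg _).trans (hC' 0))⟩
  map_add' g h := Subtype.ext (funext fun
    | 0 => (add_zero _).symm
    | n + 1 => map_add (T n) _ _)
  map_smul' c h := Subtype.ext (funext fun
    | 0 => (smul_zero (A := H 0) c).symm
    | n + 1 => map_smul (T n) c _)

/-- Uniformly bounded operators which lower the index by one. -/
def shiftDown (T : ∀ n, H (n + 1) →L[ℂ] H n) (hT : ∃ C, ∀ n, ‖T n‖ ≤ C) :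
    boundedSeq H →ₗ[ℂ] boundedSeq H where
  toFun h := ⟨fun n => T n (h.1 (n + 1)), by
    obtain ⟨C, hC⟩ := hT
    obtain ⟨C', hC'⟩ := h.2
    exact ⟨C * C', fun n => (T n).le_of_opNorm_le_of_le (hC n) (hC' (n + 1))⟩⟩
  map_add' g h := Subtype.ext (funext fun n => map_add (T n) _ _)
  map_smul' c h := Subtype.ext (funext fun n => map_smul (T n) c _)

variable [∀ n, CompleteSpace (H n)]

/-- Termwise, the relations of a covariant representation hold at all indices from 1 on. The Banach
limit forgets index 0 and absorbs the index shift made by t(ξ), so they hold exactly on the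
completion. -/
theorem exists_limit_representation {π : ∀ n, A →⋆ₙₐ[ℂ] (H n →L[ℂ] H n)}
    (hπ : ∀ n, Function.Injective (π n)) (S : ∀ n, Step φ (π n) (π (n + 1))) :
    ∃ (K : Type w) (_ : NormedAddCommGroup K) (_ : InnerProductSpace ℂ K) (_ : CompleteSpace K)
      (r : Representation φ (K →L[ℂ] K)), r.IsCovariant ∧ Function.Injective r.π := by
  obtain ⟨Λ, hΛa, hΛm, hΛs, hΛp, hΛt⟩ := exists_banachLimit
  let c : PreInnerProductSpace.Core ℂ (boundedSeq H) :=
    { inner := fun g h => Λ fun n => inner ℂ (g.1 n) (h.1 n)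
      conj_inner_symm := fun g h => by
        refine (hΛs _ (bounded_inner h g)).symm.trans (congrArg Λ (funext fun n => ?_))
        exact inner_conj_symm _ _
      re_inner_nonneg := fun g => hΛp 0 _ (bounded_inner g g) fun n => inner_self_nonneg (𝕜 := ℂ)
      add_left := fun f g h => by
        rw [← hΛa _ _ (bounded_inner f h) (bounded_inner g h)]
        exact congrArg Λ (funext fun n => _root_.inner_add_left _ _ _)
      smul_left := fun g h z => by
        rw [← hΛm _ _ (bounded_inner g h)]
        exact congrArg Λ (funext fun n => _root_.inner_smul_left _ _ _) }
  obtain ⟨K, i1, i2, i3, ι, hι, hin⟩ := exists_completion c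
  replace hin : ∀ g h, inner ℂ (ι g) (ι h) = Λ fun n => inner ℂ (g.1 n) (h.1 n) := hin
  -- Shift invariance makes the term of index 0 invisible.
  have hext : ∀ {g h : boundedSeq H}, (∀ n, g.1 (n + 1) = h.1 (n + 1)) → ι g = ι h := by
    intro g h hgh
    refine eq_of_inner_dense hι fun f => ?_
    rw [hin, hin, ← hΛt _ (bounded_inner f g), ← hΛt _ (bounded_inner f h)]
    simp only [hgh]
  obtain ⟨P, hP⟩ := exists_starHom hι
    (fun a => diagMap (fun n => π n a) ⟨‖a‖, fun n => NonUnitalStarAlgHom.norm_apply_le (π n) a⟩)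
    (fun a g h => by
      rw [hin, hin]
      refine congrArg Λ (funext fun n => ?_)
      change inner ℂ (π n a (g.1 n)) (h.1 n) = inner ℂ (g.1 n) (π n (star a) (h.1 n))
      rw [map_star, ContinuousLinearMap.star_eq_adjoint, ContinuousLinearMap.adjoint_inner_right])
    (fun a b g => by
      rw [← map_add]
      refine congrArg ι (Subtype.ext (funext fun n => ?_))
      change π n (a + b) (g.1 n) = π n a (g.1 n) + π n b (g.1 n)
      rw [map_add, _root_.add_apply])
    (fun z a g => by
      rw [← map_smul]
      refine congrArg ι (Subtype.ext (funext fun n => ?_))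
      change π n (z • a) (g.1 n) = z • π n a (g.1 n)
      rw [map_smul, _root_.smul_apply])
    (fun a b g => by
      refine congrArg ι (Subtype.ext (funext fun n => ?_))
      change π n (a * b) (g.1 n) = π n a (π n b (g.1 n))
      rw [map_mul, mul_apply_eq_comp])
  -- No step ends at `H 0`, so 𝓛(X) has no given action there; by `hext` the value 0 does no harm.
  let D : Adj A X → ∀ n, H n →L[ℂ] H n := fun s => fun
    | 0 => 0
    | n + 1 => (S n).L s
  have hD : ∀ s n, ‖D s n‖ ≤ ‖s‖ := fun s => fun
    | 0 => norm_zero.trans_le (norm_nonneg s)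
    | n + 1 => NonUnitalStarAlgHom.norm_apply_le (S n).L s
  obtain ⟨L, hL⟩ := exists_starHom hι (fun s => diagMap (D s) ⟨‖s‖, hD s⟩)
    (fun s g h => by
      rw [hin, hin, ← hΛt _ (bounded_inner _ _), ← hΛt _ (bounded_inner g _)]
      refine congrArg Λ (funext fun n => ?_)
      change inner ℂ ((S n).L s (g.1 (n + 1))) (h.1 (n + 1)) =
        inner ℂ (g.1 (n + 1)) ((S n).L (star s) (h.1 (n + 1)))
      rw [map_star, ContinuousLinearMap.star_eq_adjoint, ContinuousLinearMap.adjoint_inner_right])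
    (fun a b g => by
      rw [← map_add]
      refine hext fun n => ?_
      change (S n).L (a + b) (g.1 (n + 1)) = (S n).L a (g.1 (n + 1)) + (S n).L b (g.1 (n + 1))
      rw [map_add, _root_.add_apply])
    (fun z a g => by
      rw [← map_smul]
      refine hext fun n => ?_
      change (S n).L (z • a) (g.1 (n + 1)) = z • (S n).L a (g.1 (n + 1))
      rw [map_smul, _root_.smul_apply])
    (fun a b g => by
      refine hext fun n => ?_
      change (S n).L (a * b) (g.1 (n + 1)) = (S n).L a ((S n).L b (g.1 (n + 1)))
      rw [map_mul, mul_apply_eq_comp])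
  let up : X → boundedSeq H →ₗ[ℂ] boundedSeq H := fun ξ =>
    shiftUp (fun n => (S n).T ξ) ⟨‖ξ‖, fun n => (S n).norm_T_le ξ⟩
  let down : X → boundedSeq H →ₗ[ℂ] boundedSeq H := fun ξ =>
    shiftDown (fun n => ContinuousLinearMap.adjoint ((S n).T ξ))
      ⟨‖ξ‖, fun n => (LinearIsometryEquiv.norm_map _ _).trans_le ((S n).norm_T_le ξ)⟩
  have hinner : ∀ ξ η g h, inner ℂ (ι (up ξ g)) (ι (up η h)) =
      inner ℂ (ι g) (P (inner A ξ η) (ι h)) := by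
    intro ξ η g h
    -- Shifting drops the zero term of the raised sequences and realigns the rest, which reduces the
    -- claim to `inner_T` at each index.
    rw [hP, hin, hin, ← hΛt _ (bounded_inner _ _)]
    exact congrArg Λ (funext fun n => (S n).inner_T ξ η _ _)
  have hbound : ∀ ξ g, ‖ι (up ξ g)‖ ≤ ‖ξ‖ * ‖ι g‖ := by
    intro ξ g
    refine le_of_sq_le_sq ?_ (by positivity)
    rw [← inner_self_eq_norm_sq (𝕜 := ℂ), hinner]
    calc _ ≤ ‖ι g‖ * ‖P (inner A ξ ξ) (ι g)‖ := re_inner_le_norm _ _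
      _ ≤ ‖ι g‖ * (‖ξ‖ ^ 2 * ‖ι g‖) := by
        gcongr
        refine (ContinuousLinearMap.le_opNorm _ _).trans ?_
        gcongr
        rw [norm_sq (A := A)]
        exact NonUnitalStarAlgHom.norm_apply_le P _
      _ = _ := by ring
  let t₀ : X → K →L[ℂ] K := fun ξ => (ι.comp (up ξ)).extendOfNorm ι
  have ht₀ : ∀ ξ g, t₀ ξ (ι g) = ι (up ξ g) := fun ξ g =>
    LinearMap.extendOfNorm_eq hι ⟨‖ξ‖, hbound ξ⟩ g
  have hdown : ∀ ξ g, ContinuousLinearMap.adjoint (t₀ ξ) (ι g) = ι (down ξ g) := by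
    intro ξ g
    refine eq_of_inner_dense hι fun f => ?_
    rw [ContinuousLinearMap.adjoint_inner_right, ht₀, hin, hin, ← hΛt _ (bounded_inner _ _)]
    exact congrArg Λ (funext fun n =>
      (ContinuousLinearMap.adjoint_inner_right ((S n).T ξ) (f.1 n) (g.1 (n + 1))).symm)
  let r : Representation φ (K →L[ℂ] K) :=
    { π := P
      t :=
        { toFun := t₀
          map_add' := fun ξ η => clm_ext_dense hι fun g => by
            rw [_root_.add_apply, ht₀, ht₀, ht₀, ← map_add]
            refine hext fun n => ?_
            change (S n).T (ξ + η) (g.1 n) = (S n).T ξ (g.1 n) + (S n).T η (g.1 n)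
            rw [map_add, _root_.add_apply]
          map_smul' := fun z ξ => clm_ext_dense hι fun g => by
            rw [_root_.smul_apply, ht₀, ht₀, ← map_smul]
            refine hext fun n => ?_
            change (S n).T (z • ξ) (g.1 n) = z • (S n).T ξ (g.1 n)
            rw [map_smul, _root_.smul_apply] }
      star_t_mul_t := fun ξ η => clm_ext_dense hι fun h => eq_of_inner_dense hι fun g => by
        change inner ℂ (ι g) (ContinuousLinearMap.adjoint (t₀ ξ) (t₀ η (ι h))) = _
        rw [ContinuousLinearMap.adjoint_inner_right, ht₀, ht₀, hinner]
      π_mul_t := fun a ξ => clm_ext_dense hι fun g => by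
        change P a (t₀ ξ (ι g)) = t₀ _ (ι g)
        rw [ht₀, ht₀, hP]
        exact hext fun n => (S n).left_T a ξ (g.1 n) }
  refine ⟨K, i1, i2, i3, r, fun a ha => ?_, (injective_iff_map_eq_zero P).mpr fun a ha => ?_⟩
  -- The restriction of `L` to 𝓚(X) sends θ_{ξ,η} to t(ξ)t(η)*, so by uniqueness it is ψ_t.
  · rw [← r.eq_psi (ψ := L.comp (NonUnitalStarSubalgebraClass.subtype (compacts A X)))
      fun ξ η => clm_ext_dense hι fun g => ?_]
    · change P a = L (φ a)
      refine clm_ext_dense hι fun g => ?_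
      rw [hP, hL]
      exact hext fun n => congrArg (fun B : H (n + 1) →L[ℂ] H (n + 1) => B (g.1 (n + 1)))
        ((S n).left_eq a ha)
    · change L (theta A ξ η) (ι g) = t₀ ξ (ContinuousLinearMap.adjoint (t₀ η) (ι g))
      rw [hdown, ht₀, hL]
      exact hext fun n => (S n).L_theta ξ η (g.1 (n + 1))
  · by_contra ha0
    have hpos : 0 < ‖a‖ := norm_pos_iff.mpr ha0
    -- Each `π n` is isometric, so one lower bound serves all n; the Banach limit of ‖πₙ(a)xₙ‖² is
    -- then at least (‖a‖/2)² > 0.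
    have hex : ∀ n, ∃ x : H n, ‖x‖ < 1 ∧ ‖a‖ / 2 < ‖π n a x‖ := fun n => by
      refine ContinuousLinearMap.exists_lt_apply_of_lt_opNorm (π n a) ?_
      rw [NonUnitalStarAlgHom.norm_map (π n) (hπ n)]
      linarith
    choose x hx hx' using hex
    let g : boundedSeq H := diagMap (fun n => π n a)
      ⟨‖a‖, fun n => NonUnitalStarAlgHom.norm_apply_le (π n) a⟩ ⟨x, 1, fun n => (hx n).le⟩
    have h1 : ι g = 0 := by rw [← hP, ha, _root_.zero_apply]
    have h2 := hΛp ((‖a‖ / 2) ^ 2) _ (bounded_inner g g) fun n => by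
      change _ ≤ RCLike.re (inner ℂ (π n a (x n)) (π n a (x n)))
      rw [inner_self_eq_norm_sq]
      gcongr
      exact (hx' n).le
    rw [← hin, h1, _root_.inner_zero_right, Complex.zero_re] at h2
    have : 0 < (‖a‖ / 2) ^ 2 := by positivity
    linarith

variable (A) in
/-- A faithful representation of `A` on a Hilbert space. -/
structure FaithfulRep : Type (max u (w + 1)) where
  K : Type w
  [normed : NormedAddCommGroup K]
  [innerProduct : InnerProductSpace ℂ K]
  [complete : CompleteSpace K]
  π : A →⋆ₙₐ[ℂ] (K →L[ℂ] K)
  injective : Function.Injective π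

attribute [instance] FaithfulRep.normed FaithfulRep.innerProduct FaithfulRep.complete

variable (φ) in
/-- Every C⋆-correspondence has an injective covariant representation. -/
theorem exists_injective_covariant :
    ∃ (B : Type (max u v)) (_ : NonUnitalCStarAlgebra B) (r : Representation φ B),
      r.IsCovariant ∧ Function.Injective r.π := by
  have hnext : ∀ F : FaithfulRep.{u, max u v} A, ∃ F' : FaithfulRep.{u, max u v} A,
      Nonempty (Step φ F.π F'.π) := fun F => by
    obtain ⟨K, _, _, _, π', h', hS⟩ := exists_step φ F.π F.injective
    exact ⟨⟨K, π', h'⟩, hS⟩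
  choose next hS using hnext
  obtain ⟨H₀, _, _, _, π₀, h₀⟩ := exists_faithful.{u, v} A
  let F : ℕ → FaithfulRep.{u, max u v} A := fun n => next^[n] ⟨H₀, π₀, h₀⟩
  have hF : ∀ n, Nonempty (Step φ (F n).π (F (n + 1)).π) := fun n => by
    have : F (n + 1) = next (F n) := Function.iterate_succ_apply' next n _
    rw [this]
    exact hS (F n)
  obtain ⟨K, _, _, _, r, hr, hr'⟩ := exists_limit_representation (φ := φ)
    (fun n => (F n).injective) fun n => (hF n).some
  exact ⟨K →L[ℂ] K, inferInstance, r, hr, hr'⟩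

lemma Representation.isometry_t {B : Type*} [NonUnitalCStarAlgebra B] (r : Representation φ B)
    (h : Isometry r.π) : Isometry r.t := by
  refine AddMonoidHomClass.isometry_of_norm r.t fun ξ => ?_
  have h1 : ‖r.π (inner A ξ ξ)‖ = ‖(inner A ξ ξ : A)‖ := h.norm_map_of_map_zero (map_zero r.π) _
  rw [← r.star_t_mul_t, CStarRing.norm_star_mul_self, ← norm_sq, ← pow_two] at h1
  exact (pow_left_inj₀ (norm_nonneg _) (norm_nonneg _) two_ne_zero).mp h1

end Limit

end

end CStarCorr

theorem mainTheorem1 {A : Type*} {X : Type*} [NonUnitalCStarAlgebra A] [PartialOrder A]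
    [StarOrderedRing A] [NormedAddCommGroup X] [NormedSpace ℂ X] [CompleteSpace X] [SMul Aᵐᵒᵖ X]
    [CStarCorr.HilbertModule A X] (φ : A →⋆ₙₐ[ℂ] CStarCorr.Adj A X) :
    (CStarCorr.universalRep φ).IsUniversal ∧
      Function.Injective (CStarCorr.universalRep φ).π ∧
      Isometry (CStarCorr.universalRep φ).π ∧
      Isometry (CStarCorr.universalRep φ).t := by
  have hu := CStarCorr.universalRep_isUniversal φ
  obtain ⟨B, _, s, hs, hs'⟩ := CStarCorr.exists_injective_covariant φ
  -- An injective s.π equal to ρ ∘ π_X forces π_X to be injective.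
  obtain ⟨ρ, ⟨hρ, -⟩, -⟩ := hu.existsUnique_hom B s hs
  have hinj : Function.Injective (CStarCorr.universalRep φ).π := fun a b hab =>
    hs' (by rw [← hρ, ← hρ, hab])
  have hiso : Isometry (CStarCorr.universalRep φ).π :=
    NonUnitalStarAlgHom.isometry (CStarCorr.universalRep φ).π hinj
  exact ⟨hu, hinj, hiso, (CStarCorr.universalRep φ).isometry_t hiso⟩
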